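/- **Definitions.** A tile $\tau$ in $\mathbb{R}^d$ is a pair consisting of a nonempty compact set $\mathrm{spt}(\tau)\subset\mathbb{R}^d$ that is the closure of its interior and a mark from a fixed finite set; $\tau+v$ is the tile with support $\mathrm{spt}(\tau)+v$ and the same mark. A patch is a collection of tiles with pairwise disjoint interiors, its support is the union of the supports of its tiles, and a tiling is a patch with support $\mathbb{R}^d$. For a tiling $T$ and $R\ge 0$, $B_R[T]$ is the set of tiles of $T$ whose support meets the closed ball of radius $R$ about $0$. Let $\mathcal{A}=\{\rho_1,\dots,\rho_k\}$ be a finite set of translationally inequivalent tiles and $\Lambda$ an expanding linear isomorphism of $\mathbb{R}^d$. A substitution $\Phi$ on $\mathcal{A}$ with expansion $\Lambda$ assigns to each $\rho_i$ a patch $\Phi(\rho_i)$ of translates of elements of $\mathcal{A}$ with support $\Lambda(\mathrm{spt}(\rho_i))$; it is extended to collections of translates of prototiles by $\Phi(\{\rho_{i(j)}+v_j\}_{j\in J})=\bigcup_{j\in J}(\Phi(\rho_{i(j)})+\Lambda v_j)$. A patch is allowed if it is contained in $\Phi^m(\rho_i)-v$ for some $m\ge1$, $i$ and $v\in\mathbb{R}^d$.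 The substitution tiling space $\Omega_\Phi$ is the set of all tilings of $\mathbb{R}^d$ all of whose finite patches are allowed. It is self-similar if $\Lambda$ is multiplication by a scalar $\lambda>1$; non-periodic if $T-v=T$ with $T\in\Omega_\Phi$ implies $v=0$; and it has (translationally) finite local complexity (FLC) if for each $R$ there are, up to translation, only finitely many patches $P\subset T\in\Omega_\Phi$ of diameter at most $R$. Distances between tilings are measured by $$d(T,T')=\inf\bigl(\{1\}\cup\{\epsilon>0:\ \exists\, v,v'\in\mathbb{R}^d,\ |v|,|v'|<\epsilon/2,\ B_{1/\epsilon}[T'-v']=B_{1/\epsilon}[T-v]\}\bigr).$$ For $T,T'\in\Omega_\Phi$ write $T\sim_sT'$ if $d(\Phi^n(T),\Phi^n(T'))\to0$ as $n\to\infty$. A pair $(T,T')\in\Omega_\Phi\times\Omega_\Phi$ is a branch pair if $T\nsim_sT'$ and there is an open half-space $H=\{x\in\mathbb{R}^d:\langle x,u\rangle>0\}$, $u\in\mathbb{S}^{d-1}$, with $T-x\sim_sT'-x$ for all $x\in H$. For such an $H$, the connected component of $\{v\in\mathbb{S}^{d-1}: T-tv\sim_sT'-tv\ \ \forall t>0\}$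 that contains $H\cap\mathbb{S}^{d-1}$ is called an asymptotic sector of $(T,T')$. A tiling $T$ is periodic under $\Phi$ if $\Phi^n(T)=T$ for some $n\ge1$. **Proposition.** Let $\Phi$ be a substitution in $\mathbb{R}^d$ such that $\Omega_\Phi$ is non-periodic, has FLC and is self-similar, and let $S\subset\mathbb{S}^{d-1}$ be a set whose interior (in $\mathbb{S}^{d-1}$) contains a closed hemisphere $\{v\in\mathbb{S}^{d-1}:\langle v,u\rangle\ge0\}$, $u\in\mathbb{S}^{d-1}$. If $(T,T')$ is a branch pair that has an asymptotic sector containing $S$, then $T$ and $T'$ are both periodic under $\Phi$. Moreover, there are only finitely many such branch pairs $(T,T')$. -/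

import Mathlib

open scoped Pointwise

noncomputable section

namespace SubstTiling

/-- Euclidean space of dimension `d`. -/
abbrev E (d : ℕ) : Type := EuclideanSpace ℝ (Fin d)

/-- The unit sphere of directions in Euclidean space of dimension `d`. -/
abbrev Directions (d : ℕ) : Type := Metric.sphere (0 : E d) 1

/-- A (topologically regular) tile: a nonempty compact support that is the closure of its interior,
together with a mark. -/
@[ext]
structure Tile (d : ℕ) (M : Type*) where
  spt : Set (E d)
  mark : M
  isCompact_spt : IsCompact spt
  nonempty_spt : spt.Nonempty
  closure_interior_spt : closure (interior spt) = spt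

variable {d : ℕ} {M : Type*}

/-- Translation of tiles: `v +ᵥ τ` is the tile `τ + v`. With the pointwise action on sets,
`v +ᵥ P` is the translate `P + v` of a collection of tiles, and `(-v) +ᵥ P` is `P - v`. -/
instance : VAdd (E d) (Tile d M) where
  vadd v τ :=
    { spt := v +ᵥ τ.spt
      mark := τ.mark
      isCompact_spt := τ.isCompact_spt.vadd v
      nonempty_spt := τ.nonempty_spt.vadd_set
      closure_interior_spt := by
        rw [interior_vadd, closure_vadd, τ.closure_interior_spt] }

@[simp] theorem Tile.spt_vadd (v : E d) (τ : Tile d M) : (v +ᵥ τ).spt = v +ᵥ τ.spt := rfl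

@[simp] theorem Tile.mark_vadd (v : E d) (τ : Tile d M) : (v +ᵥ τ).mark = τ.mark := rfl

instance : AddAction (E d) (Tile d M) where
  zero_vadd τ := by ext1 <;> simp
  add_vadd v w τ := by ext1 <;> simp [add_vadd]

/-- A patch: a collection of tiles with pairwise disjoint interiors. -/
def IsPatch (P : Set (Tile d M)) : Prop :=
  P.Pairwise fun τ σ => Disjoint (interior τ.spt) (interior σ.spt)

/-- The support of a collection of tiles. -/
def support (P : Set (Tile d M)) : Set (E d) := ⋃ τ ∈ P, τ.spt

/-- A tiling: a patch whose support is the whole space. -/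
def IsTiling (T : Set (Tile d M)) : Prop := IsPatch T ∧ support T = Set.univ

/-- `patchAt R T` is the collection `B_R[T]` of tiles of `T` that meet the closed ball of radius `R`
about the origin; for `R = 0` these are the tiles whose support contains the origin. -/
def patchAt (R : ℝ) (T : Set (Tile d M)) : Set (Tile d M) :=
  {τ ∈ T | (Metric.closedBall (0 : E d) R ∩ τ.spt).Nonempty}

/-- The tiling metric: two tilings are close if they agree in a large ball about the origin
after small translations. -/
def tilingDist (T T' : Set (Tile d M)) : ℝ :=
  sInf (insert 1 {ε : ℝ | 0 < ε ∧ ∃ v v' : E d, ‖v‖ < ε / 2 ∧ ‖v'‖ < ε / 2 ∧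
    patchAt (1 / ε) ((-v') +ᵥ T') = patchAt (1 / ε) ((-v) +ᵥ T)})

/-- Translationally finite local complexity of a collection of tilings: for each `R`, there are,
up to translation, only finitely many patches of diameter at most `R` in the tilings. -/
def HasFLC (Ω : Set (Set (Tile d M))) : Prop :=
  ∀ R : ℝ, ∃ F : Set (Set (Tile d M)), F.Finite ∧
    ∀ T ∈ Ω, ∀ P ⊆ T, Metric.ediam (support P) ≤ ENNReal.ofReal R →
      ∃ Q ∈ F, ∃ v : E d, P = v +ᵥ Q

/-- The translation action on the collection of tilings is free. -/
def IsNonPeriodic (Ω : Set (Set (Tile d M))) : Prop :=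
  ∀ T ∈ Ω, ∀ v : E d, (-v) +ᵥ T = T → v = 0

/-- A substitution with expansion `Λ` on a finite set of translationally inequivalent prototiles. -/
structure Substitution (d : ℕ) (M : Type*) where
  prototiles : Set (Tile d M)
  finite_prototiles : prototiles.Finite
  inequivalent : ∀ ρ ∈ prototiles, ∀ σ ∈ prototiles, ∀ v : E d, v +ᵥ ρ = σ → ρ = σ
  /-- the expansion, a linear isomorphism under which every nonzero vector grows without bound
  (equivalently, all of whose complex eigenvalues have modulus larger than one) -/
  Λ : E d ≃L[ℝ] E d
  expanding : ∀ v : E d, v ≠ 0 → Filter.Tendsto (fun n : ℕ => ‖Λ^[n] v‖) Filter.atTop Filter.atTop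
  /-- the value of the substitution on prototiles -/
  subst : prototiles → Set (Tile d M)
  isPatch_subst : ∀ ρ, IsPatch (subst ρ)
  subst_tiles : ∀ ρ, ∀ τ ∈ subst ρ, ∃ σ ∈ prototiles, ∃ v : E d, τ = v +ᵥ σ
  support_subst : ∀ ρ : prototiles, support (subst ρ) = Λ '' (ρ : Tile d M).spt

namespace Substitution

variable (Φ : Substitution d M)

/-- The extension of the substitution to collections of translates of prototiles: the union of
`Φ(ρ) + Λ v` over all tiles `ρ + v` in the collection. -/
def map (P : Set (Tile d M)) : Set (Tile d M) :=
  ⋃ (ρ : Φ.prototiles) (v : E d) (_ : v +ᵥ (ρ : Tile d M) ∈ P), Φ.Λ v +ᵥ Φ.subst ρ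

/-- A patch is allowed if it is contained in a translate of some `Φ^m(ρ)`, `m ≥ 1`. -/
def IsAllowed (P : Set (Tile d M)) : Prop :=
  ∃ m : ℕ, 1 ≤ m ∧ ∃ ρ ∈ Φ.prototiles, ∃ v : E d, P ⊆ (-v) +ᵥ (Φ.map^[m] {ρ})

/-- The substitution tiling space: all tilings each of whose finite patches is allowed. -/
def tilingSpace : Set (Set (Tile d M)) :=
  {T | IsTiling T ∧ ∀ P ⊆ T, P.Finite → Φ.IsAllowed P}

/-- The substitution is self-similar if its expansion is multiplication by some scalar `> 1`. -/
def IsSelfSimilar : Prop := ∃ c : ℝ, 1 < c ∧ ∀ v : E d, Φ.Λ v = c • v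

/-- The stable manifold of `T`. -/
def stableManifold (T : Set (Tile d M)) : Set (Set (Tile d M)) :=
  {T' ∈ Φ.tilingSpace |
    Filter.Tendsto (fun n : ℕ => tilingDist (Φ.map^[n] T') (Φ.map^[n] T)) Filter.atTop (nhds 0)}

/-- Stable equivalence of two tilings. -/
def StablyEquiv (T T' : Set (Tile d M)) : Prop := T ∈ Φ.stableManifold T'

/-- `T - x` and `T' - x` are stably equivalent for all `x` in the open half-space
with inner normal `u`. -/
def StablyEquivOnHalfSpace (T T' : Set (Tile d M)) (u : Directions d) : Prop :=
  ∀ x : E d, 0 < inner ℝ x (u : E d) → Φ.StablyEquiv ((-x) +ᵥ T) ((-x) +ᵥ T')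

/-- Branch pairs: tilings of the tiling space that are not stably equivalent, but are so after
translation by any element of some open half-space. -/
def IsBranchPair (T T' : Set (Tile d M)) : Prop :=
  T ∈ Φ.tilingSpace ∧ T' ∈ Φ.tilingSpace ∧ ¬ Φ.StablyEquiv T T' ∧
    ∃ u : Directions d, Φ.StablyEquivOnHalfSpace T T' u

/-- The directions `v` with `T - t v` and `T' - t v` stably equivalent for all `t > 0`. -/
def stableDirections (T T' : Set (Tile d M)) : Set (Directions d) :=
  {v | ∀ t : ℝ, 0 < t → Φ.StablyEquiv ((-(t • (v : E d))) +ᵥ T) ((-(t • (v : E d))) +ᵥ T')}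

/-- `C` is an asymptotic sector of `(T, T')`: for an open half-space `H` on which `T` and `T'` are
stably equivalent, `C` is the connected component of the set of stable directions that contains
the directions in `H`. -/
def IsAsymptoticSector (T T' : Set (Tile d M)) (C : Set (Directions d)) : Prop :=
  ∃ u : Directions d, Φ.StablyEquivOnHalfSpace T T' u ∧
    (∃ w ∈ Φ.stableDirections T T', C = connectedComponentIn (Φ.stableDirections T T') w) ∧
    {v : Directions d | 0 < inner ℝ (v : E d) (u : E d)} ⊆ C

/-- A tiling is periodic under the substitution. -/
def IsPeriodic (T : Set (Tile d M)) : Prop := ∃ n : ℕ, 0 < n ∧ Φ.map^[n] T = T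

end Substitution

/-- The set of directions `S` contains a closed hemisphere in its interior. -/
def ContainsClosedHemisphereInInterior (S : Set (Directions d)) : Prop :=
  ∃ u : Directions d, {v : Directions d | 0 ≤ inner ℝ (v : E d) (u : E d)} ⊆ interior S

end SubstTiling

end

namespace SubstTiling

open Filter Topology

/-! ### Translates of tiles, patches and tilings -/

variable {d : ℕ} {M : Type*}

/-! By self-similarity, stable equivalence is local: it holds iff for some n the tilings `Φⁿ(T)` and
`Φⁿ(T')` have the same tiles at the origin (`stablyEquiv_iff`). A branch pair whose sector contains
a closed hemisphere about `u` therefore becomes a pair that eventually agrees at every nonzero point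
of a closed half-space but never at 0, an element of `closedBranchPairs u`.

Such pairs are rigid (`exists_rigidity`). Suppose that near the origin the tilings of `q` are small
translates of those of `p`, by x and x'. Around `2u` both pairs have become equal, so the second
tiling of `p` eventually agrees with its translate by x' - x on a fixed ball. Non-periodicity and
FLC forbid this unless x = x' (`exists_repulsion`). The points of non-agreement, 0 for `q` and 0
moved by x for `p`, then coincide: x or -x lies in the closed half-space, where agreement holds away
from 0.

By FLC there are finitely many local pictures up to small translations (`exists_coloring`), and `Φ`
is onto, so every pair has an infinite backward orbit (`exists_map_mem_closedBranchPairs`). Two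
pairs whose backward orbits share their limiting picture agree, by rigidity, on a fixed ball
arbitrarily far back. Inflating forward makes them equal. Hence the set of pairs is finite, and a
backward orbit in a finite set repeats, which gives periodicity. -/

theorem Tile.mem_vadd_spt {v x : E d} {τ : Tile d M} : x ∈ (v +ᵥ τ).spt ↔ x - v ∈ τ.spt := by
  rw [Tile.spt_vadd, Set.mem_vadd_set_iff_neg_vadd_mem, vadd_eq_add, neg_add_eq_sub]

theorem mem_vadd_collection {v : E d} {τ : Tile d M} {P : Set (Tile d M)} :
    τ ∈ v +ᵥ P ↔ (-v) +ᵥ τ ∈ P := Set.mem_vadd_set_iff_neg_vadd_mem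

theorem Tile.nonempty_interior (τ : Tile d M) : (interior τ.spt).Nonempty := by
  rw [← closure_nonempty_iff, τ.closure_interior_spt]
  exact τ.nonempty_spt

/-- Compactness: all points `x + n • v` would stay in the bounded support. -/
theorem Tile.eq_zero_of_vadd_eq_self {v : E d} {τ : Tile d M} (h : v +ᵥ τ = τ) : v = 0 := by
  obtain ⟨x, hx⟩ := τ.nonempty_spt
  obtain ⟨C, hC⟩ := τ.isCompact_spt.isBounded.exists_norm_le
  have key : ∀ n : ℕ, x + n • v ∈ τ.spt := by
    intro n
    induction n with
    | zero => simpa using hx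
    | succ n ih =>
      rw [← h, Tile.mem_vadd_spt]
      convert ih using 1
      rw [succ_nsmul]; abel
  by_contra hv
  obtain ⟨n, hn⟩ := exists_nat_gt (2 * C / ‖v‖)
  have hv' : 0 < ‖v‖ := norm_pos_iff.mpr hv
  rw [div_lt_iff₀ hv'] at hn
  have h1 : ‖n • v‖ ≤ ‖x + n • v‖ + ‖x‖ := by
    simpa using norm_sub_le (x + n • v) x
  rw [← Nat.cast_smul_eq_nsmul ℝ, norm_smul, Real.norm_natCast, Nat.cast_smul_eq_nsmul ℝ] at h1
  linarith [hC _ (key n), hC _ hx]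

theorem Tile.vadd_right_injective {v w : E d} {τ : Tile d M} (h : v +ᵥ τ = w +ᵥ τ) : v = w := by
  have : (-w + v) +ᵥ τ = τ := by rw [add_vadd, h, neg_vadd_vadd]
  have := Tile.eq_zero_of_vadd_eq_self this
  rwa [neg_add_eq_zero, eq_comm] at this

theorem isPatch_vadd {P : Set (Tile d M)} (h : IsPatch P) (v : E d) : IsPatch (v +ᵥ P) := by
  intro τ hτ σ hσ hne
  rw [mem_vadd_collection] at hτ hσ
  have := h hτ hσ (fun h => hne (by simpa using h))
  simp only [Tile.spt_vadd, interior_vadd] at this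
  rw [Set.disjoint_left] at this ⊢
  intro x hx hy
  exact this (Set.vadd_mem_vadd_set hx) (Set.vadd_mem_vadd_set hy)

theorem mem_support {P : Set (Tile d M)} {x : E d} : x ∈ support P ↔ ∃ τ ∈ P, x ∈ τ.spt := by
  simp [support]

theorem IsTiling.exists_mem {T : Set (Tile d M)} (h : IsTiling T) (x : E d) :
    ∃ τ ∈ T, x ∈ τ.spt := mem_support.mp (h.2 ▸ Set.mem_univ x)

theorem isTiling_vadd {T : Set (Tile d M)} (h : IsTiling T) (v : E d) : IsTiling (v +ᵥ T) := by
  refine ⟨isPatch_vadd h.1 v, Set.eq_univ_of_forall fun x => mem_support.mpr ?_⟩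
  obtain ⟨τ, hτ, hx⟩ := h.exists_mem (x - v)
  exact ⟨v +ᵥ τ, Set.vadd_mem_vadd_set hτ, Tile.mem_vadd_spt.mpr hx⟩

/-- A patch that contains a tiling is equal to it. -/
theorem IsTiling.eq_of_subset {T P : Set (Tile d M)} (h : IsTiling T) (hP : IsPatch P)
    (hTP : T ⊆ P) : T = P := by
  refine hTP.antisymm fun τ hτ => ?_
  obtain ⟨x, hx⟩ := τ.nonempty_interior
  obtain ⟨σ, hσ, hxσ⟩ := h.exists_mem x
  by_contra hn
  have hd := hP hτ (hTP hσ) (fun e => hn (e ▸ hσ))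
  rw [← σ.closure_interior_spt, mem_closure_iff] at hxσ
  obtain ⟨y, hy, hy'⟩ := hxσ _ isOpen_interior hx
  exact Set.disjoint_left.mp hd hy hy'

/-! ### The extended substitution and its action on the tiling space -/

namespace Substitution

variable (Φ : Substitution d M)

/-- All tiles of the collection are translates of prototiles. -/
def HasPrototiles (P : Set (Tile d M)) : Prop :=
  ∀ τ ∈ P, ∃ σ ∈ Φ.prototiles, ∃ v : E d, τ = v +ᵥ σ

variable {Φ}

theorem mem_map {P : Set (Tile d M)} {τ : Tile d M} :
    τ ∈ Φ.map P ↔ ∃ (ρ : Φ.prototiles) (v : E d), v +ᵥ (ρ : Tile d M) ∈ P ∧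
      (-Φ.Λ v) +ᵥ τ ∈ Φ.subst ρ := by
  simp only [map, Set.mem_iUnion, exists_prop, mem_vadd_collection]

theorem map_mono {P Q : Set (Tile d M)} (h : P ⊆ Q) : Φ.map P ⊆ Φ.map Q := by
  intro τ hτ
  rw [mem_map] at hτ ⊢
  obtain ⟨ρ, v, h1, h2⟩ := hτ
  exact ⟨ρ, v, h h1, h2⟩

theorem map_vadd (v : E d) (P : Set (Tile d M)) : Φ.map (v +ᵥ P) = Φ.Λ v +ᵥ Φ.map P := by
  ext τ
  rw [mem_vadd_collection, mem_map, mem_map]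
  constructor
  · rintro ⟨ρ, w, h1, h2⟩
    refine ⟨ρ, -v + w, ?_, ?_⟩
    · rwa [mem_vadd_collection, ← add_vadd] at h1
    · rw [← add_vadd]
      convert h2 using 2
      rw [map_add, map_neg]; abel
  · rintro ⟨ρ, w, h1, h2⟩
    refine ⟨ρ, v + w, ?_, ?_⟩
    · rwa [mem_vadd_collection, ← add_vadd, neg_add_cancel_left]
    · rw [← add_vadd] at h2
      convert h2 using 2
      rw [map_add]; abel

theorem hasPrototiles_vadd {P : Set (Tile d M)} (h : Φ.HasPrototiles P) (v : E d) :
    Φ.HasPrototiles (v +ᵥ P) := by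
  intro τ hτ
  obtain ⟨σ, hσ, w, hw⟩ := h _ (mem_vadd_collection.mp hτ)
  exact ⟨σ, hσ, v + w, by rw [add_vadd, ← hw, vadd_neg_vadd]⟩

theorem hasPrototiles_map (P : Set (Tile d M)) : Φ.HasPrototiles (Φ.map P) := by
  intro τ hτ
  obtain ⟨ρ, v, -, h⟩ := mem_map.mp hτ
  obtain ⟨σ, hσ, w, hw⟩ := Φ.subst_tiles _ _ h
  exact ⟨σ, hσ, Φ.Λ v + w, by rw [add_vadd, ← hw, vadd_neg_vadd]⟩

/-- The support of a tile of `Φ(ρ) + Λ v` is contained in the inflated support of `ρ + v`. -/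
theorem mem_spt_of_mem_subst {ρ : Φ.prototiles} {v x : E d} {τ : Tile d M}
    (h : (-Φ.Λ v) +ᵥ τ ∈ Φ.subst ρ) (hx : Φ.Λ x ∈ τ.spt) :
    x ∈ (v +ᵥ (ρ : Tile d M)).spt := by
  have h1 : Φ.Λ (x - v) ∈ support (Φ.subst ρ) := by
    refine mem_support.mpr ⟨_, h, ?_⟩
    rw [Tile.mem_vadd_spt]
    convert hx using 1
    rw [map_sub]; abel
  rw [Φ.support_subst] at h1
  obtain ⟨y, hy, hyx⟩ := h1
  rw [Tile.mem_vadd_spt, ← Φ.Λ.injective hyx]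
  exact hy

theorem isPatch_map {P : Set (Tile d M)} (hP : IsPatch P) : IsPatch (Φ.map P) := by
  intro τ hτ σ hσ hne
  obtain ⟨ρ, v, h1, h2⟩ := mem_map.mp hτ
  obtain ⟨ρ', v', h1', h2'⟩ := mem_map.mp hσ
  -- By `inequivalent` a parent tile determines its prototile and its offset, so children of one
  -- parent lie in one substituted patch. For distinct parents, an overlap pulls back under `Λ` to
  -- an overlap of the parents.
  by_cases heq : v +ᵥ (ρ : Tile d M) = v' +ᵥ (ρ' : Tile d M)
  · have h3 : (ρ : Tile d M) = ρ' :=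
      Φ.inequivalent _ ρ.2 _ ρ'.2 (-v' + v) (by rw [add_vadd, heq, neg_vadd_vadd])
    obtain rfl : ρ = ρ' := Subtype.ext h3
    obtain rfl := Tile.vadd_right_injective heq
    have h4 : τ ∈ Φ.Λ v +ᵥ Φ.subst ρ := mem_vadd_collection.mpr h2
    exact isPatch_vadd (Φ.isPatch_subst ρ) _ h4 (mem_vadd_collection.mpr h2') hne
  · have hd : Disjoint _ _ := hP h1 h1' heq
    rw [Set.disjoint_left] at hd ⊢
    intro x hx hx'
    obtain ⟨y, rfl⟩ := Φ.Λ.surjective x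
    have key : ∀ {ρ : Φ.prototiles} {v : E d} {τ : Tile d M}, (-Φ.Λ v) +ᵥ τ ∈ Φ.subst ρ →
        Φ.Λ y ∈ interior τ.spt → y ∈ interior (v +ᵥ (ρ : Tile d M)).spt := by
      intro ρ v τ h hy
      rw [mem_interior_iff_mem_nhds] at hy ⊢
      filter_upwards [Φ.Λ.continuous.continuousAt.preimage_mem_nhds hy] with z hz
      exact mem_spt_of_mem_subst h hz
    exact hd (key h2 hx) (key h2' hx')

theorem exists_mem_map {P : Set (Tile d M)} {ρ : Φ.prototiles} {v x : E d}
    (h : v +ᵥ (ρ : Tile d M) ∈ P) (hx : x ∈ (v +ᵥ (ρ : Tile d M)).spt) :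
    ∃ τ ∈ Φ.map P, Φ.Λ x ∈ τ.spt := by
  rw [Tile.mem_vadd_spt] at hx
  have h1 : Φ.Λ (x - v) ∈ support (Φ.subst ρ) := by
    rw [Φ.support_subst]; exact ⟨_, hx, rfl⟩
  obtain ⟨τ, hτ, hxτ⟩ := mem_support.mp h1
  refine ⟨Φ.Λ v +ᵥ τ, mem_map.mpr ⟨ρ, v, h, by rwa [neg_vadd_vadd]⟩, ?_⟩
  rwa [Tile.mem_vadd_spt, ← map_sub]

theorem isTiling_map {T : Set (Tile d M)} (h : IsTiling T) (hT : Φ.HasPrototiles T) :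
    IsTiling (Φ.map T) := by
  refine ⟨isPatch_map h.1, Set.eq_univ_of_forall fun x => mem_support.mpr ?_⟩
  obtain ⟨y, rfl⟩ := Φ.Λ.surjective x
  obtain ⟨τ, hτ, hx⟩ := h.exists_mem y
  obtain ⟨σ, hσ, v, rfl⟩ := hT τ hτ
  exact exists_mem_map (ρ := ⟨σ, hσ⟩) hτ hx

theorem hasPrototiles_iterate {P : Set (Tile d M)} (h : Φ.HasPrototiles P) (n : ℕ) :
    Φ.HasPrototiles (Φ.map^[n] P) := by
  cases n with
  | zero => exact h
  | succ n => rw [Function.iterate_succ_apply']; exact hasPrototiles_map _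

theorem isPatch_iterate {P : Set (Tile d M)} (h : IsPatch P) (n : ℕ) :
    IsPatch (Φ.map^[n] P) := by
  induction n with
  | zero => exact h
  | succ n ih => rw [Function.iterate_succ_apply']; exact isPatch_map ih

theorem map_iterate_vadd (n : ℕ) (v : E d) (P : Set (Tile d M)) :
    Φ.map^[n] (v +ᵥ P) = Φ.Λ^[n] v +ᵥ Φ.map^[n] P := by
  induction n with
  | zero => rfl
  | succ n ih => simp only [Function.iterate_succ_apply', ih, map_vadd]

theorem IsAllowed.mono {P Q : Set (Tile d M)} (h : Φ.IsAllowed Q) (hPQ : P ⊆ Q) :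
    Φ.IsAllowed P := by
  obtain ⟨m, hm, ρ, hρ, v, hv⟩ := h
  exact ⟨m, hm, ρ, hρ, v, hPQ.trans hv⟩

theorem IsAllowed.hasPrototiles {P : Set (Tile d M)} (h : Φ.IsAllowed P) :
    Φ.HasPrototiles P := by
  obtain ⟨m, hm, ρ, hρ, v, hv⟩ := h
  intro τ hτ
  refine hasPrototiles_vadd (hasPrototiles_iterate ?_ m) _ _ (hv hτ)
  rintro σ rfl
  exact ⟨σ, hρ, 0, (zero_vadd _ _).symm⟩

theorem IsAllowed.isPatch {P : Set (Tile d M)} (h : Φ.IsAllowed P) : IsPatch P := by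
  obtain ⟨m, hm, ρ, hρ, v, hv⟩ := h
  exact Set.Pairwise.mono hv (isPatch_vadd (isPatch_iterate (Set.pairwise_singleton _ _) m) _)

theorem IsAllowed.vadd {P : Set (Tile d M)} (h : Φ.IsAllowed P) (w : E d) :
    Φ.IsAllowed (w +ᵥ P) := by
  obtain ⟨m, hm, ρ, hρ, v, hv⟩ := h
  refine ⟨m, hm, ρ, hρ, v - w, ?_⟩
  rw [neg_sub, sub_eq_add_neg, add_vadd]
  exact Set.vadd_set_mono hv

theorem IsAllowed.map {P : Set (Tile d M)} (h : Φ.IsAllowed P) : Φ.IsAllowed (Φ.map P) := by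
  obtain ⟨m, hm, ρ, hρ, v, hv⟩ := h
  refine ⟨m + 1, by omega, ρ, hρ, Φ.Λ v, ?_⟩
  rw [Function.iterate_succ_apply', ← map_neg, ← map_vadd]
  exact map_mono hv

theorem hasPrototiles_of_mem {T : Set (Tile d M)} (h : T ∈ Φ.tilingSpace) :
    Φ.HasPrototiles T := fun τ hτ =>
  (h.2 {τ} (by simpa using hτ) (Set.finite_singleton τ)).hasPrototiles τ rfl

theorem vadd_mem_tilingSpace {T : Set (Tile d M)} (h : T ∈ Φ.tilingSpace) (v : E d) :
    v +ᵥ T ∈ Φ.tilingSpace := by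
  refine ⟨isTiling_vadd h.1 v, fun P hP hfin => ?_⟩
  have := (h.2 ((-v) +ᵥ P) ?_ hfin.vadd_set).vadd v
  · rwa [vadd_neg_vadd] at this
  · rw [← neg_vadd_vadd v T]; exact Set.vadd_set_mono hP

/-- A finite patch of `Φ(T)` is covered by the image of a finite set of parents, and images of
allowed patches are allowed. -/
theorem map_mem_tilingSpace {T : Set (Tile d M)} (h : T ∈ Φ.tilingSpace) :
    Φ.map T ∈ Φ.tilingSpace := by
  refine ⟨isTiling_map h.1 (hasPrototiles_of_mem h), fun P hP hfin => ?_⟩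
  have h1 : ∀ τ ∈ P, ∃ σ ∈ T, τ ∈ Φ.map {σ} := by
    intro τ hτ
    obtain ⟨ρ, v, h1, h2⟩ := mem_map.mp (hP hτ)
    exact ⟨_, h1, mem_map.mpr ⟨ρ, v, rfl, h2⟩⟩
  choose! f hf hf' using h1
  refine (h.2 (f '' P) (by rintro _ ⟨τ, hτ, rfl⟩; exact hf τ hτ) (hfin.image f)).map.mono ?_
  intro τ hτ
  exact map_mono (by simpa using ⟨τ, hτ, rfl⟩) (hf' τ hτ)

theorem iterate_mem_tilingSpace {T : Set (Tile d M)} (h : T ∈ Φ.tilingSpace) (n : ℕ) :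
    Φ.map^[n] T ∈ Φ.tilingSpace := by
  induction n with
  | zero => exact h
  | succ n ih => rw [Function.iterate_succ_apply']; exact map_mem_tilingSpace ih

/-! ### Local finiteness -/

variable (Φ)

/-- The prototiles lie in a common ball. -/
theorem exists_norm_le_of_prototile :
    ∃ D : ℝ, 0 ≤ D ∧ ∀ ρ ∈ Φ.prototiles, ∀ x ∈ ρ.spt, ‖x‖ ≤ D := by
  have h : Bornology.IsBounded (⋃ ρ ∈ Φ.prototiles, ρ.spt) :=
    (Bornology.isBounded_biUnion Φ.finite_prototiles).mpr fun ρ _ => ρ.isCompact_spt.isBounded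
  obtain ⟨D, hD⟩ := h.exists_norm_le
  refine ⟨max D 0, le_max_right _ _, fun ρ hρ x hx => (hD x ?_).trans (le_max_left _ _)⟩
  exact Set.mem_biUnion hρ hx

/-- All translates of prototiles contain balls of a common radius. -/
theorem exists_ball_subset :
    ∃ r : ℝ, 0 < r ∧ r ≤ 1 ∧ ∀ ρ ∈ Φ.prototiles, ∀ v : E d, ∃ x,
      Metric.ball x r ⊆ interior (v +ᵥ ρ).spt := by
  have h : ∀ ρ ∈ Φ.prototiles, ∀ᶠ r in 𝓝[>] (0 : ℝ), ∃ x, Metric.ball x r ⊆ interior ρ.spt := by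
    intro ρ _
    obtain ⟨x, hx⟩ := ρ.nonempty_interior
    obtain ⟨r, hr, hr'⟩ := Metric.isOpen_iff.mp isOpen_interior x hx
    filter_upwards [Ioo_mem_nhdsGT hr] with s hs
    exact ⟨x, (Metric.ball_subset_ball hs.2.le).trans hr'⟩
  have h2 := (Filter.eventually_all_finite Φ.finite_prototiles).mpr h
  obtain ⟨r, hr, hr'⟩ := (h2.and (Ioo_mem_nhdsGT (zero_lt_one' ℝ))).exists
  refine ⟨r, hr'.1, hr'.2.le, fun ρ hρ v => ?_⟩
  obtain ⟨x, hx⟩ := hr ρ hρ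
  refine ⟨v +ᵥ x, ?_⟩
  rw [Tile.spt_vadd, interior_vadd, ← Metric.vadd_ball]
  exact Set.vadd_set_mono hx

variable {Φ}

theorem norm_le_of_mem_spt {D : ℝ} (hD : ∀ ρ ∈ Φ.prototiles, ∀ x ∈ ρ.spt, ‖x‖ ≤ D)
    {P : Set (Tile d M)} (hP : Φ.HasPrototiles P) {τ : Tile d M} {x y : E d} (hτ : τ ∈ P)
    (hx : x ∈ τ.spt) (hy : y ∈ τ.spt) : ‖y‖ ≤ ‖x‖ + 2 * D := by
  obtain ⟨σ, hσ, v, rfl⟩ := hP τ hτ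
  rw [Tile.mem_vadd_spt] at hx hy
  have h1 := hD _ hσ _ hx
  have h2 := hD _ hσ _ hy
  have h3 : y = x + ((y - v) - (x - v)) := by abel
  calc ‖y‖ = ‖x + ((y - v) - (x - v))‖ := by rw [← h3]
    _ ≤ ‖x‖ + (‖y - v‖ + ‖x - v‖) := (norm_add_le _ _).trans (by gcongr; exact norm_sub_le _ _)
    _ ≤ _ := by linarith

/-- Patches of translates of prototiles are locally finite. -/
theorem finite_patchAt {P : Set (Tile d M)} (hP : IsPatch P) (hP' : Φ.HasPrototiles P) (R : ℝ) :
    (patchAt R P).Finite := by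
  obtain ⟨D, -, hD⟩ := Φ.exists_norm_le_of_prototile
  obtain ⟨r, hr, -, hr'⟩ := Φ.exists_ball_subset
  have h : ∀ τ : patchAt R P, ∃ x, Metric.ball x r ⊆ interior (τ : Tile d M).spt := by
    rintro ⟨τ, hτ, -⟩
    obtain ⟨σ, hσ, v, rfl⟩ := hP' τ hτ
    exact hr' σ hσ v
  choose f hf using h
  -- Volume count: the tiles contain disjoint balls of one radius `r`, all inside the ball of radius
  -- `R + 2 * D`.
  have hfin := MeasureTheory.Measure.finite_const_le_meas_of_disjoint_iUnion
    (MeasureTheory.volume : MeasureTheory.Measure (E d))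
    (ε := MeasureTheory.volume (Metric.ball (0 : E d) r)) (Metric.measure_ball_pos _ _ hr)
    (As := fun τ => Metric.ball (f τ) r) (fun _ => measurableSet_ball) ?_ ?_
  · have huniv : {i | MeasureTheory.volume (Metric.ball (0 : E d) r) ≤
        MeasureTheory.volume (Metric.ball (f i) r)} = Set.univ :=
      Set.eq_univ_of_forall fun i =>
        (MeasureTheory.Measure.addHaar_ball_center _ (f i) r).ge
    rw [huniv, Set.finite_univ_iff] at hfin
    exact hfin
  · intro τ σ hne
    exact (hP τ.2.1 σ.2.1 (fun h => hne (Subtype.ext h))).mono (hf τ) (hf σ)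
  · refine ne_top_of_le_ne_top (MeasureTheory.measure_closedBall_lt_top (x := (0 : E d)) (r := R + 2 * D)).ne
      (MeasureTheory.measure_mono ?_)
    refine Set.iUnion_subset fun τ y hy => ?_
    obtain ⟨x, hx, hx'⟩ := τ.2.2
    rw [mem_closedBall_zero_iff] at hx ⊢
    have := norm_le_of_mem_spt hD hP' τ.2.1 hx' (interior_subset (hf τ hy))
    linarith

theorem finite_subst (ρ : Φ.prototiles) : (Φ.subst ρ).Finite := by
  have hb : Bornology.IsBounded (support (Φ.subst ρ)) := by
    rw [Φ.support_subst]
    exact ((ρ : Tile d M).isCompact_spt.image Φ.Λ.continuous).isBounded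
  obtain ⟨C, hC⟩ := hb.exists_norm_le
  refine (finite_patchAt (Φ := Φ) (Φ.isPatch_subst ρ) (Φ.subst_tiles ρ) C).subset ?_
  intro τ hτ
  obtain ⟨x, hx⟩ := τ.nonempty_spt
  exact ⟨hτ, x, by simpa using hC x (mem_support.mpr ⟨τ, hτ, hx⟩), hx⟩

end Substitution

/-! ### Pointwise agreement of tilings and its propagation under the substitution -/

/-- Two collections have the same tiles at the point `x`. -/
def AgreeAt (x : E d) (T T' : Set (Tile d M)) : Prop :=
  ∀ τ : Tile d M, x ∈ τ.spt → (τ ∈ T ↔ τ ∈ T')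

theorem AgreeAt.symm {x : E d} {T T' : Set (Tile d M)} (h : AgreeAt x T T') : AgreeAt x T' T :=
  fun τ hτ => (h τ hτ).symm

theorem AgreeAt.trans {x : E d} {T T' T'' : Set (Tile d M)} (h : AgreeAt x T T')
    (h' : AgreeAt x T' T'') : AgreeAt x T T'' := fun τ hτ => (h τ hτ).trans (h' τ hτ)

theorem AgreeAt.vadd {x : E d} {T T' : Set (Tile d M)} (h : AgreeAt x T T') (v : E d) :
    AgreeAt (v + x) (v +ᵥ T) (v +ᵥ T') := by
  intro τ hτ
  rw [mem_vadd_collection, mem_vadd_collection]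
  refine h _ ?_
  rw [Tile.mem_vadd_spt]
  convert hτ using 1
  abel

theorem eq_of_forall_agreeAt {T T' : Set (Tile d M)} (h : ∀ x, AgreeAt x T T') : T = T' := by
  ext τ
  obtain ⟨x, hx⟩ := τ.nonempty_spt
  exact h x τ hx

theorem patchAt_eq_iff {R : ℝ} {T T' : Set (Tile d M)} :
    patchAt R T = patchAt R T' ↔ ∀ x : E d, ‖x‖ ≤ R → AgreeAt x T T' := by
  constructor
  · intro h x hx τ hτ
    have h1 : (Metric.closedBall (0 : E d) R ∩ τ.spt).Nonempty := ⟨x, by simpa using hx, hτ⟩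
    have h2 := Set.ext_iff.mp h τ
    simpa [patchAt, h1] using h2
  · intro h
    ext τ
    constructor
    · rintro ⟨hτ, x, hx, hx'⟩
      exact ⟨(h x (by simpa using hx) τ hx').mp hτ, x, hx, hx'⟩
    · rintro ⟨hτ, x, hx, hx'⟩
      exact ⟨(h x (by simpa using hx) τ hx').mpr hτ, x, hx, hx'⟩

namespace Substitution

variable {Φ : Substitution d M}

/-- A tile of `Φ(T)` at `Λ x` can only come from a tile of `T` at `x`. -/
theorem agreeAt_map {x : E d} {T T' : Set (Tile d M)} (h : AgreeAt x T T') :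
    AgreeAt (Φ.Λ x) (Φ.map T) (Φ.map T') := by
  have key : ∀ {T T' : Set (Tile d M)}, AgreeAt x T T' → ∀ τ : Tile d M, Φ.Λ x ∈ τ.spt →
      τ ∈ Φ.map T → τ ∈ Φ.map T' := by
    intro T T' h τ hx hτ
    obtain ⟨ρ, v, h1, h2⟩ := mem_map.mp hτ
    exact mem_map.mpr ⟨ρ, v, (h _ (mem_spt_of_mem_subst h2 hx)).mp h1, h2⟩
  exact fun τ hx => ⟨key h τ hx, key h.symm τ hx⟩

variable (Φ)

/-- `Φⁿ(T)` and `Φⁿ(T')` have the same tiles at `Λⁿ x`. -/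
def AgreeAfter (n : ℕ) (x : E d) (T T' : Set (Tile d M)) : Prop :=
  AgreeAt (Φ.Λ^[n] x) (Φ.map^[n] T) (Φ.map^[n] T')

variable {Φ}

theorem AgreeAfter.symm {n : ℕ} {x : E d} {T T' : Set (Tile d M)} (h : Φ.AgreeAfter n x T T') :
    Φ.AgreeAfter n x T' T := AgreeAt.symm h

theorem AgreeAfter.trans {n : ℕ} {x : E d} {T T' T'' : Set (Tile d M)}
    (h : Φ.AgreeAfter n x T T') (h' : Φ.AgreeAfter n x T' T'') : Φ.AgreeAfter n x T T'' :=
  AgreeAt.trans h h'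

theorem iterate_Λ_add (n : ℕ) (x y : E d) : Φ.Λ^[n] (x + y) = Φ.Λ^[n] x + Φ.Λ^[n] y :=
  iterate_map_add Φ.Λ n x y

theorem AgreeAfter.vadd {n : ℕ} {x : E d} {T T' : Set (Tile d M)} (h : Φ.AgreeAfter n x T T')
    (v : E d) : Φ.AgreeAfter n (v + x) (v +ᵥ T) (v +ᵥ T') := by
  unfold AgreeAfter
  rw [map_iterate_vadd, map_iterate_vadd, iterate_Λ_add]
  exact AgreeAt.vadd h _

theorem AgreeAfter.succ {n : ℕ} {x : E d} {T T' : Set (Tile d M)} (h : Φ.AgreeAfter n x T T') :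
    Φ.AgreeAfter (n + 1) x T T' := by
  unfold AgreeAfter
  simp only [Function.iterate_succ_apply']
  exact agreeAt_map h

theorem AgreeAfter.mono {n m : ℕ} {x : E d} {T T' : Set (Tile d M)} (h : Φ.AgreeAfter n x T T')
    (hnm : n ≤ m) : Φ.AgreeAfter m x T T' := by
  induction m, hnm using Nat.le_induction with
  | base => exact h
  | succ m _ ih => exact ih.succ

theorem agreeAfter_of_agreeAt {x : E d} {T T' : Set (Tile d M)} (h : AgreeAt x T T') (n : ℕ) :
    Φ.AgreeAfter n x T T' := AgreeAfter.mono (n := 0) h n.zero_le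

theorem agreeAfter_add {n m : ℕ} {x : E d} {T T' : Set (Tile d M)} :
    Φ.AgreeAfter (n + m) x T T' ↔ Φ.AgreeAfter n (Φ.Λ^[m] x) (Φ.map^[m] T) (Φ.map^[m] T') := by
  unfold AgreeAfter
  simp only [Function.iterate_add_apply]

/-- Agreement of tilings is an open condition. -/
theorem AgreeAt.eventually {x : E d} {T T' : Set (Tile d M)} (hT : T ∈ Φ.tilingSpace)
    (hT' : T' ∈ Φ.tilingSpace) (h : AgreeAt x T T') : ∀ᶠ y in 𝓝 x, AgreeAt y T T' := by
  -- Only finitely many tiles meet a neighbourhood of `x`. Those that miss `x` are closed, so they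
  -- also miss all points near `x`.
  have key : ∀ T ∈ Φ.tilingSpace, ∀ᶠ y in 𝓝 x, ∀ τ ∈ T, y ∈ τ.spt → x ∈ τ.spt := by
    intro T hT
    have hfin := finite_patchAt hT.1.1 (hasPrototiles_of_mem hT) (‖x‖ + 1)
    have h1 : ∀ᶠ y in 𝓝 x, ∀ τ ∈ patchAt (‖x‖ + 1) T, y ∈ τ.spt → x ∈ τ.spt := by
      refine (eventually_all_finite hfin).mpr fun τ _ => ?_
      by_cases hx : x ∈ τ.spt
      · exact Eventually.of_forall fun _ _ => hx
      · filter_upwards [τ.isCompact_spt.isClosed.isOpen_compl.mem_nhds hx] with y hy hy'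
        exact absurd hy' hy
    have h2 : ∀ᶠ y in 𝓝 x, ‖y‖ < ‖x‖ + 1 :=
      continuous_norm.continuousAt.eventually_lt continuousAt_const (by simp)
    filter_upwards [h1, h2] with y hy hy2 τ hτ hyτ
    exact hy τ ⟨hτ, y, by simpa using hy2.le, hyτ⟩ hyτ
  filter_upwards [key T hT, key T' hT'] with y h1 h2 τ hτ
  exact ⟨fun hm => (h τ (h1 τ hm hτ)).mp hm, fun hm => (h τ (h2 τ hm hτ)).mpr hm⟩

theorem AgreeAfter.eventually {n : ℕ} {x : E d} {T T' : Set (Tile d M)}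
    (hT : T ∈ Φ.tilingSpace) (hT' : T' ∈ Φ.tilingSpace) (h : Φ.AgreeAfter n x T T') :
    ∀ᶠ y in 𝓝 x, Φ.AgreeAfter n y T T' :=
  (Φ.Λ.continuous.iterate n).continuousAt.eventually
    (AgreeAt.eventually (iterate_mem_tilingSpace hT n) (iterate_mem_tilingSpace hT' n) h)

/-- Pointwise eventual agreement is uniform on compact sets. -/
theorem exists_agreeAfter_of_isCompact {K : Set (E d)} (hK : IsCompact K)
    {T T' : Set (Tile d M)} (hT : T ∈ Φ.tilingSpace) (hT' : T' ∈ Φ.tilingSpace)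
    (h : ∀ x ∈ K, ∃ n, Φ.AgreeAfter n x T T') : ∃ N, ∀ n ≥ N, ∀ x ∈ K, Φ.AgreeAfter n x T T' := by
  refine hK.induction_on (p := fun s => ∃ N, ∀ n ≥ N, ∀ x ∈ s, Φ.AgreeAfter n x T T')
    ⟨0, by simp⟩ ?_ ?_ ?_
  · rintro s t hst ⟨N, hN⟩
    exact ⟨N, fun n hn x hx => hN n hn x (hst hx)⟩
  · rintro s t ⟨N, hN⟩ ⟨N', hN'⟩
    refine ⟨max N N', fun n hn x hx => hx.elim (hN n (le_of_max_le_left hn) x)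
      (hN' n (le_of_max_le_right hn) x)⟩
  · intro x hx
    obtain ⟨n, hn⟩ := h x hx
    exact ⟨_, mem_nhdsWithin_of_mem_nhds (hn.eventually hT hT'), n,
      fun m hm y hy => AgreeAfter.mono hy hm⟩

/-! ### Stable equivalence as eventual agreement at the origin -/

variable (Φ) in
/-- Distinct small translates of a tiling agree at no point. -/
theorem exists_pos_eq_of_agreeAt : ∃ r : ℝ, 0 < r ∧ r ≤ 1 ∧ ∀ T ∈ Φ.tilingSpace,
    ∀ x v w : E d, ‖v - w‖ < r → AgreeAt x (v +ᵥ T) (w +ᵥ T) → v = w := by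
  obtain ⟨r, hr, hr1, h⟩ := Φ.exists_ball_subset
  refine ⟨r, hr, hr1, fun T hT x v w hvw hag => ?_⟩
  obtain ⟨τ, hτ, hx⟩ := (isTiling_vadd hT.1 v).exists_mem x
  have hτ' := (hag τ hx).mp hτ
  rw [mem_vadd_collection] at hτ hτ'
  by_contra hne
  have hd : Disjoint (interior _) (interior _) := hT.1.1 hτ hτ'
    (fun e => hne (neg_injective (Tile.vadd_right_injective e)))
  obtain ⟨σ, hσ, a, ha⟩ := hasPrototiles_of_mem hT _ hτ
  obtain ⟨c, hc⟩ := h σ hσ a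
  -- The ball about `c` in the interior of `τ - v` also contains `c + (w - v)`, which translates
  -- back to `c` in the interior of `τ - w`. The two tiles of `T` thus overlap.
  rw [← ha] at hc
  have hc0 := hc (Metric.mem_ball_self hr)
  have hc1 : c + (w - v) ∈ interior ((-v) +ᵥ τ).spt :=
    hc (by simpa [Metric.mem_ball, dist_eq_norm, norm_sub_rev] using hvw)
  have e : (-v) +ᵥ τ = (w - v) +ᵥ ((-w) +ᵥ τ) := by
    rw [← add_vadd]; congr 1; abel
  rw [e, Tile.spt_vadd, interior_vadd, Set.mem_vadd_set_iff_neg_vadd_mem, vadd_eq_add] at hc1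
  rw [show -(w - v) + (c + (w - v)) = c by abel] at hc1
  exact Set.disjoint_left.mp hd hc0 hc1

theorem iterate_Λ_eq {c : ℝ} (hΛ : ∀ v : E d, Φ.Λ v = c • v) (n : ℕ) (v : E d) : Φ.Λ^[n] v = c ^ n • v := by
  induction n with
  | zero => simp
  | succ n ih => rw [Function.iterate_succ_apply', ih, hΛ, smul_smul, pow_succ']

theorem exists_of_tilingDist_lt {ε : ℝ} (hε : ε ≤ 1) {T T' : Set (Tile d M)}
    (h : tilingDist T T' < ε) :
    ∃ v v' : E d, ‖v‖ < ε / 2 ∧ ‖v'‖ < ε / 2 ∧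
      ∀ x : E d, ‖x‖ ≤ 1 / ε → AgreeAt x (v' +ᵥ T') (v +ᵥ T) := by
  obtain ⟨δ, hδ, hlt⟩ := exists_lt_of_csInf_lt (Set.insert_nonempty _ _) h
  rcases hδ with rfl | ⟨hδ, v, v', hv, hv', heq⟩
  -- The default value 1 in the infimum is excluded by `ε ≤ 1`.
  · exact absurd hε (not_le.mpr hlt)
  · rw [patchAt_eq_iff] at heq
    refine ⟨-v, -v', by rw [norm_neg]; linarith, by rw [norm_neg]; linarith, fun x hx => heq x ?_⟩
    exact hx.trans (one_div_le_one_div_of_le hδ hlt.le)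

theorem tilingDist_nonneg (T T' : Set (Tile d M)) : 0 ≤ tilingDist T T' := by
  refine Real.sInf_nonneg ?_
  rintro x (rfl | hx)
  · exact zero_le_one
  · exact hx.1.le

theorem tilingDist_le {ε : ℝ} (hε : 0 < ε) {T T' : Set (Tile d M)}
    (h : ∀ x : E d, ‖x‖ ≤ 1 / ε → AgreeAt x T T') : tilingDist T T' ≤ ε := by
  refine csInf_le ⟨0, ?_⟩ (Or.inr ⟨hε, 0, 0, by simpa using hε, by simpa using hε, ?_⟩)
  · rintro x (rfl | hx)
    · exact zero_le_one
    · exact hx.1.le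
  · rw [neg_zero, zero_vadd, zero_vadd, patchAt_eq_iff]
    exact fun x hx => (h x hx).symm

/-- Stable equivalence means that the images under some power of the substitution have the same
tiles at the origin. -/
theorem stablyEquiv_iff (hΦ : Φ.IsSelfSimilar) {T T' : Set (Tile d M)} (hT : T ∈ Φ.tilingSpace)
    (hT' : T' ∈ Φ.tilingSpace) : Φ.StablyEquiv T T' ↔ ∃ n, Φ.AgreeAfter n 0 T T' := by
  obtain ⟨c, hc, hΛ⟩ := hΦ
  constructor
  · rintro ⟨-, hlim⟩
    obtain ⟨r, hr, hr1, hsep⟩ := Φ.exists_pos_eq_of_agreeAt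
    -- Chosen so that `w (n + 1)` and `c • w n`, of norms below `ε` and `c * ε`, fall within the
    -- separation constant `r` of each other.
    obtain ⟨ε, hε, hε1⟩ : ∃ ε : ℝ, 0 < ε ∧ ε * (c + 1) < r :=
      ⟨r / (c + 1) / 2, by positivity, by field_simp; norm_num⟩
    have hεle : ε ≤ 1 / 2 := by nlinarith
    have hεi : 2 ≤ 1 / ε := by rw [le_div_iff₀ hε]; linarith
    obtain ⟨N, hN⟩ := (hlim.eventually (gt_mem_nhds hε)).exists_forall_of_atTop
    have hw : ∀ n, ∃ w : E d, ‖w‖ < ε ∧ ∀ x : E d, ‖x‖ ≤ 1 →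
        AgreeAt x (w +ᵥ Φ.map^[n + N] T') (Φ.map^[n + N] T) := by
      intro n
      obtain ⟨v, v', hv, hv', hag⟩ :=
        exists_of_tilingDist_lt (by linarith) (hN (n + N) (Nat.le_add_left _ _))
      refine ⟨-v + v', ?_, fun x hx => ?_⟩
      · refine (norm_add_le _ _).trans_lt ?_
        rw [norm_neg]; linarith
      · have := (hag (v + x) ((norm_add_le _ _).trans (by linarith))).vadd (-v)
        rwa [neg_add_cancel_left, neg_vadd_vadd, ← add_vadd] at this
    choose w hwε hw using hw
    -- Applying `Φ` multiplies the matching offset by `c`, and short offsets are unique. The offsets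
    -- thus grow geometrically while staying below `ε`, so they vanish.
    have hstep : ∀ n, w (n + 1) = c • w n := by
      intro n
      have h1 := hw (n + 1) 0 (by simp)
      have h2 := agreeAt_map (Φ := Φ) (hw n 0 (by simp))
      rw [map_zero, map_vadd, hΛ, ← Function.iterate_succ_apply' Φ.map,
        ← Function.iterate_succ_apply' Φ.map, show (n + N).succ = n + 1 + N by omega] at h2
      refine hsep _ (iterate_mem_tilingSpace hT' (n + 1 + N)) 0 _ _ ?_ (h1.trans h2.symm)
      refine (norm_sub_le _ _).trans_lt ?_
      rw [norm_smul, Real.norm_of_nonneg (by linarith)]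
      nlinarith [hwε n, hwε (n + 1)]
    have hpow : ∀ n, w n = c ^ n • w 0 := by
      intro n
      induction n with
      | zero => simp
      | succ n ih => rw [hstep, ih, smul_smul, pow_succ']
    have hw0 : w 0 = 0 := by
      by_contra hne
      have hpos := norm_pos_iff.mpr hne
      obtain ⟨n, hn⟩ := pow_unbounded_of_one_lt (ε / ‖w 0‖) hc
      have h1 := hwε n
      rw [hpow, norm_smul, Real.norm_of_nonneg (by positivity)] at h1
      rw [div_lt_iff₀ hpos] at hn
      linarith
    have h0 := hw 0 0 (by simp)
    rw [hw0, zero_vadd, zero_add] at h0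
    refine ⟨N, ?_⟩
    unfold AgreeAfter
    rw [iterate_Λ_eq hΛ, smul_zero]
    exact h0.symm
  · rintro ⟨n, hn⟩
    refine ⟨hT, ?_⟩
    have h1 := hn.eventually hT hT'
    rw [Metric.eventually_nhds_iff] at h1
    obtain ⟨δ, hδ, hag⟩ := h1
    rw [Metric.tendsto_atTop]
    intro ε hε
    have hgrow := (tendsto_pow_atTop_atTop_of_one_lt hc).eventually_gt_atTop (1 / (ε / 2) / δ)
    obtain ⟨N, hN⟩ := hgrow.exists_forall_of_atTop
    refine ⟨max n N, fun m hm => ?_⟩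
    rw [Real.dist_0_eq_abs, abs_of_nonneg (tilingDist_nonneg _ _)]
    refine (tilingDist_le (half_pos hε) fun x hx => ?_).trans_lt (half_lt_self hε)
    have hcm : 0 < c ^ m := by positivity
    -- Agreement on a `δ`-ball at stage `n` inflates to agreement on a ball of radius of order `c ^
    -- m * δ`, which exceeds `1 / (ε / 2)`.
    have h2 : Φ.AgreeAfter m ((c ^ m)⁻¹ • x) T T' := by
      refine AgreeAfter.mono (hag ?_) (le_of_max_le_left hm)
      rw [dist_zero_right, norm_smul, norm_inv, Real.norm_of_nonneg hcm.le,
        inv_mul_lt_iff₀ hcm]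
      have := hN m (le_of_max_le_right hm)
      rw [div_lt_iff₀ hδ] at this
      linarith
    unfold AgreeAfter at h2
    rwa [iterate_Λ_eq hΛ, smul_inv_smul₀ hcm.ne'] at h2

end Substitution

/-! ### Ultralimits and surjectivity of the substitution -/

/-- The set of tiles that belong to almost all members of a sequence of collections, along a fixed
nonprincipal ultrafilter. -/
def ultralimit (Q : ℕ → Set (Tile d M)) : Set (Tile d M) :=
  {τ | ∀ᶠ n in (hyperfilter ℕ : Filter ℕ), τ ∈ Q n}

/-- Pigeonhole for an ultrafilter; it replaces all extractions of subsequences. -/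
theorem exists_eventually_eq_of_finite {α : Type*} {f : ℕ → α} {s : Set α} (hs : s.Finite)
    (h : ∀ᶠ n in (hyperfilter ℕ : Filter ℕ), f n ∈ s) :
    ∃ a ∈ s, ∀ᶠ n in (hyperfilter ℕ : Filter ℕ), f n = a := by
  have h1 : (⋃ a ∈ s, {n | f n = a}) ∈ hyperfilter ℕ := by
    refine mem_of_superset h fun n hn => ?_
    simpa using hn
  exact (Ultrafilter.finite_biUnion_mem_iff hs).mp h1

theorem eventually_hyperfilter_ge (N : ℕ) : ∀ᶠ n in (hyperfilter ℕ : Filter ℕ), N ≤ n :=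
  Nat.hyperfilter_le_atTop (eventually_ge_atTop N)

theorem eventually_subset_of_subset_ultralimit {Q : ℕ → Set (Tile d M)} {P : Set (Tile d M)}
    (hP : P ⊆ ultralimit Q) (hfin : P.Finite) :
    ∀ᶠ n in (hyperfilter ℕ : Filter ℕ), P ⊆ Q n :=
  (eventually_all_finite hfin).mpr fun _ hτ => hP hτ

theorem isPatch_ultralimit {Q : ℕ → Set (Tile d M)}
    (hQ : ∀ᶠ n in (hyperfilter ℕ : Filter ℕ), IsPatch (Q n)) : IsPatch (ultralimit Q) := by
  intro τ hτ σ hσ hne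
  obtain ⟨n, ⟨hn, h1⟩, h2⟩ := ((hQ.and hτ).and hσ).exists
  exact hn h1 h2 hne

namespace Substitution

variable {Φ : Substitution d M}

theorem isAllowed_of_subset_ultralimit {Q : ℕ → Set (Tile d M)} {P : Set (Tile d M)}
    (hQ : ∀ᶠ n in (hyperfilter ℕ : Filter ℕ), ∀ P ⊆ Q n, P.Finite → Φ.IsAllowed P)
    (hP : P ⊆ ultralimit Q) (hfin : P.Finite) : Φ.IsAllowed P := by
  obtain ⟨n, hn, h⟩ := (hQ.and (eventually_subset_of_subset_ultralimit hP hfin)).exists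
  exact hn P h hfin

/-- A tile has finitely many possible parents. -/
theorem finite_parents (σ : Tile d M) :
    {p : Φ.prototiles × E d | (-Φ.Λ p.2) +ᵥ σ ∈ Φ.subst p.1}.Finite := by
  have : Finite Φ.prototiles := Φ.finite_prototiles
  have h : ∀ ρ : Φ.prototiles, {v : E d | (-Φ.Λ v) +ᵥ σ ∈ Φ.subst ρ}.Finite := by
    intro ρ
    refine Set.Finite.preimage (f := fun v => (-Φ.Λ v) +ᵥ σ) ?_ (finite_subst ρ)
    intro v _ w _ h
    exact Φ.Λ.injective (neg_injective (Tile.vadd_right_injective h))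
  refine (Set.finite_iUnion fun ρ => (h ρ).image (Prod.mk ρ)).subset ?_
  rintro ⟨ρ, v⟩ h
  exact Set.mem_iUnion.mpr ⟨ρ, v, h, rfl⟩

/-- The substitution maps the tiling space onto itself. -/
theorem exists_map_eq (u : Directions d) {T : Set (Tile d M)} (hT : T ∈ Φ.tilingSpace) :
    ∃ T₁ ∈ Φ.tilingSpace, Φ.map T₁ = T := by
  obtain ⟨D, hD0, hD⟩ := Φ.exists_norm_le_of_prototile
  have hfin : ∀ n : ℕ, (patchAt n T).Finite := fun n =>
    finite_patchAt hT.1.1 (hasPrototiles_of_mem hT) n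
  have hex : ∀ n : ℕ, ∃ Q : Set (Tile d M), patchAt n T ⊆ Φ.map Q ∧
      (‖(Φ.Λ : E d →L[ℝ] E d)‖ * (2 * D) < n → Φ.IsAllowed Q) := by
    intro n
    obtain ⟨m, hm, ρ, hρ, v, hv⟩ := hT.2 _ (fun _ h => h.1) (hfin n)
    obtain ⟨m, rfl⟩ : ∃ k, m = k + 1 := ⟨m - 1, by omega⟩
    have hv' : patchAt n T ⊆ Φ.map ((-Φ.Λ.symm v) +ᵥ Φ.map^[m] {ρ}) := by
      rw [map_vadd, map_neg, Φ.Λ.apply_symm_apply, ← Function.iterate_succ_apply' Φ.map]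
      exact hv
    refine ⟨_, hv', fun hn => ⟨m, ?_, ρ, hρ, _, subset_rfl⟩⟩
    -- If the allowed patch came from the first substitution of one prototile, the ball of radius
    -- `n` would lie in a translate of a single inflated prototile, so `n ≤ ‖Λ‖ * 2D`. A unit vector
    -- `u` is needed to reach the boundary of the ball.
    by_contra hm0
    obtain rfl : m = 0 := by omega
    have key : ∀ x : E d, ‖x‖ ≤ n → ‖Φ.Λ.symm x + Φ.Λ.symm v‖ ≤ D := by
      intro x hx
      obtain ⟨τ, hτ, hxτ⟩ := hT.1.exists_mem x
      obtain ⟨σ, w, h1, h2⟩ := mem_map.mp (hv' ⟨hτ, x, by simpa using hx, hxτ⟩)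
      have h3 := mem_spt_of_mem_subst h2 (x := Φ.Λ.symm x) (by rwa [Φ.Λ.apply_symm_apply])
      have h4 : Φ.Λ.symm v +ᵥ (w +ᵥ (σ : Tile d M)) = ρ := by
        rw [mem_vadd_collection, neg_neg] at h1
        exact h1
      refine hD ρ hρ _ ?_
      rw [← h4, Tile.mem_vadd_spt, add_sub_cancel_right]
      exact h3
    have hu : ‖(u : E d)‖ = 1 := by simp
    have h1 := key ((n : ℝ) • (u : E d)) (by rw [norm_smul, hu]; simp)
    have h2 := key 0 (by simp)
    have h3 : ‖Φ.Λ.symm ((n : ℝ) • (u : E d))‖ ≤ 2 * D := by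
      have := norm_sub_le (Φ.Λ.symm ((n : ℝ) • (u : E d)) + Φ.Λ.symm v)
        (Φ.Λ.symm 0 + Φ.Λ.symm v)
      rw [add_sub_add_right_eq_sub, map_zero, sub_zero] at this
      rw [map_zero] at h2
      linarith
    have h4 := (Φ.Λ : E d →L[ℝ] E d).le_opNorm (Φ.Λ.symm ((n : ℝ) • (u : E d)))
    have h5 : (Φ.Λ : E d →L[ℝ] E d) (Φ.Λ.symm ((n : ℝ) • (u : E d))) = (n : ℝ) • (u : E d) :=
      Φ.Λ.apply_symm_apply _
    rw [h5, norm_smul, hu, mul_one, Real.norm_natCast] at h4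
    have := mul_le_mul_of_nonneg_left h3 (norm_nonneg (Φ.Λ : E d →L[ℝ] E d))
    linarith
  choose Q hQ hQ' using hex
  obtain ⟨N, hN⟩ := exists_nat_gt (‖(Φ.Λ : E d →L[ℝ] E d)‖ * (2 * D))
  have hall : ∀ᶠ n in (hyperfilter ℕ : Filter ℕ), Φ.IsAllowed (Q n) := by
    filter_upwards [eventually_hyperfilter_ge N] with n hn
    exact hQ' n (hN.trans_le (by exact_mod_cast hn))
  have hsub : ∀ σ ∈ T, ∃ (ρ : Φ.prototiles) (v : E d),
      v +ᵥ (ρ : Tile d M) ∈ ultralimit Q ∧ (-Φ.Λ v) +ᵥ σ ∈ Φ.subst ρ := by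
    intro σ hσ
    obtain ⟨x, hx⟩ := σ.nonempty_spt
    obtain ⟨K, hK⟩ := exists_nat_ge ‖x‖
    have h1 : ∀ n, K ≤ n → ∃ p : Φ.prototiles × E d, p.2 +ᵥ (p.1 : Tile d M) ∈ Q n ∧
        (-Φ.Λ p.2) +ᵥ σ ∈ Φ.subst p.1 := by
      intro n hn
      have hxn : ‖x‖ ≤ n := hK.trans (by exact_mod_cast hn)
      obtain ⟨ρ, v, h⟩ := mem_map.mp (hQ n ⟨hσ, x, by simpa using hxn, hx⟩)
      exact ⟨(ρ, v), h⟩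
    have : Nonempty (Φ.prototiles × E d) := ⟨(h1 K le_rfl).choose⟩
    choose! p hp hp' using h1
    -- The parent of `σ` in `Q n` varies among finitely many candidates, so one of them survives in
    -- the ultralimit.
    obtain ⟨a, ha, hev⟩ := exists_eventually_eq_of_finite (f := p) (finite_parents (Φ := Φ) σ)
      ((eventually_hyperfilter_ge K).mono fun n hn => hp' n hn)
    refine ⟨a.1, a.2, ?_, ha⟩
    show ∀ᶠ n in (hyperfilter ℕ : Filter ℕ), _
    filter_upwards [hev, eventually_hyperfilter_ge K] with n hn hKn
    rw [← hn]
    exact hp n hKn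
  have hpatch := isPatch_ultralimit (hall.mono fun n h => h.isPatch)
  refine ⟨ultralimit Q, ⟨⟨hpatch, Set.eq_univ_of_forall fun x => mem_support.mpr ?_⟩,
    fun P hP hfin => isAllowed_of_subset_ultralimit
      (hall.mono fun n h P hP _ => h.mono hP) hP hfin⟩, ?_⟩
  · obtain ⟨σ, hσ, hx⟩ := hT.1.exists_mem (Φ.Λ x)
    obtain ⟨ρ, v, h1, h2⟩ := hsub σ hσ
    exact ⟨_, h1, mem_spt_of_mem_subst h2 hx⟩
  · refine (hT.1.eq_of_subset (isPatch_map hpatch) fun σ hσ => ?_).symm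
    exact mem_map.mpr (hsub σ hσ)

/-! ### Compactness of the tiling space from FLC -/

theorem exists_finite_patchAt (hFLC : HasFLC Φ.tilingSpace) (R : ℝ) :
    ∃ F : Set (Set (Tile d M)), F.Finite ∧ (∀ Q ∈ F, Q.Finite) ∧
      ∀ T ∈ Φ.tilingSpace, ∃ Q ∈ F, ∃ v : E d, patchAt R T = v +ᵥ Q := by
  obtain ⟨D, hD0, hD⟩ := Φ.exists_norm_le_of_prototile
  -- Tiles that meet the ball of radius `R` lie in the ball of radius `R + 2 * D`.
  obtain ⟨F, hF, h⟩ := hFLC (2 * (R + 2 * D))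
  refine ⟨{Q ∈ F | Q.Finite}, hF.subset (Set.sep_subset _ _), fun Q hQ => hQ.2, fun T hT => ?_⟩
  obtain ⟨Q, hQ, v, hv⟩ := h T hT (patchAt R T) (fun _ h => h.1) (by
    refine Metric.ediam_le fun x hx y hy => ?_
    rw [edist_dist]
    refine ENNReal.ofReal_le_ofReal ?_
    have key : ∀ z ∈ support (patchAt R T), ‖z‖ ≤ R + 2 * D := by
      intro z hz
      obtain ⟨τ, ⟨hτ, a, ha, ha'⟩, hzτ⟩ := mem_support.mp hz
      rw [mem_closedBall_zero_iff] at ha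
      linarith [norm_le_of_mem_spt hD (hasPrototiles_of_mem hT) hτ ha' hzτ]
    have := dist_le_norm_add_norm x y
    linarith [key x hx, key y hy])
  refine ⟨Q, ⟨hQ, ?_⟩, v, hv⟩
  have := (finite_patchAt hT.1.1 (hasPrototiles_of_mem hT) R).vadd_set (a := -v)
  rwa [hv, neg_vadd_vadd] at this

/-- The tiling space is totally bounded: up to translations by less than `ε` there are only
finitely many patches of radius `R` about the origin. -/
theorem exists_coloring (hFLC : HasFLC Φ.tilingSpace) (R : ℝ) {ε : ℝ} (hε : 0 < ε) :
    ∃ (K : Set (Set (Tile d M) × E d)) (c : Set (Tile d M) → Set (Tile d M) × E d), K.Finite ∧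
      (∀ T ∈ Φ.tilingSpace, c T ∈ K) ∧ ∀ T ∈ Φ.tilingSpace, ∀ S ∈ Φ.tilingSpace, c T = c S →
        ∃ x : E d, ‖x‖ < ε ∧ ∀ z : E d, ‖z‖ ≤ R → AgreeAt z S (x +ᵥ T) := by
  -- The margin `ε` absorbs the translation when a tile of `x +ᵥ T` meeting the `R`-ball is moved
  -- back to `T`; `max R 0` ensures that the patches are nonempty.
  obtain ⟨F, hF, hFfin, hFex⟩ := exists_finite_patchAt hFLC (max R 0 + ε)
  obtain ⟨D, hD0, hD⟩ := Φ.exists_norm_le_of_prototile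
  have hbd : ∀ Q ∈ F, Bornology.IsBounded {v : E d | ∃ T ∈ Φ.tilingSpace,
      patchAt (max R 0 + ε) T = v +ᵥ Q} := by
    intro Q hQ
    by_cases hemp : Q = ∅
    · subst hemp
      convert Bornology.isBounded_empty
      refine Set.eq_empty_of_forall_notMem ?_
      rintro v ⟨T, hT, h⟩
      obtain ⟨τ, hτ, hx⟩ := hT.1.exists_mem 0
      have h1 : τ ∈ patchAt (max R 0 + ε) T :=
        ⟨hτ, 0, by simpa using add_nonneg (le_max_right R 0) hε.le, hx⟩
      rw [h] at h1
      simp at h1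
    · obtain ⟨τ, hτ⟩ := Set.nonempty_iff_ne_empty.mpr hemp
      obtain ⟨x, hx⟩ := τ.nonempty_spt
      rw [isBounded_iff_forall_norm_le]
      refine ⟨max R 0 + ε + 2 * D + ‖x‖, ?_⟩
      rintro v ⟨T, hT, h⟩
      have h1 : v +ᵥ τ ∈ patchAt (max R 0 + ε) T := h ▸ Set.vadd_mem_vadd_set hτ
      obtain ⟨h2, a, ha, ha'⟩ := h1
      rw [mem_closedBall_zero_iff] at ha
      have h3 : ‖v + x‖ ≤ ‖a‖ + 2 * D := norm_le_of_mem_spt hD (hasPrototiles_of_mem hT) h2 ha'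
        (by rw [Tile.mem_vadd_spt]; simpa using hx)
      have h4 : ‖v‖ ≤ ‖v + x‖ + ‖x‖ := by simpa using norm_sub_le (v + x) x
      linarith
  -- The possible offsets of each patch class are bounded, so a finite `ε / 2`-net discretises them.
  -- A colour is a class together with a net point.
  have hnet : ∀ Q ∈ F, ∃ t : Set (E d), t.Finite ∧ ∀ v : E d, (∃ T ∈ Φ.tilingSpace,
      patchAt (max R 0 + ε) T = v +ᵥ Q) → ∃ y ∈ t, dist v y < ε / 2 := by
    intro Q hQ
    obtain ⟨t, ht, hcov⟩ := Metric.totallyBounded_iff.mp 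
      ((hbd Q hQ).isCompact_closure.totallyBounded.subset subset_closure) (ε / 2)
      (half_pos hε)
    exact ⟨t, ht, fun v hv => by simpa using hcov hv⟩
  choose! t ht htn using hnet
  have hcol : ∀ T ∈ Φ.tilingSpace, ∃ p : Set (Tile d M) × E d, p.1 ∈ F ∧ p.2 ∈ t p.1 ∧
      ∃ v : E d, patchAt (max R 0 + ε) T = v +ᵥ p.1 ∧ dist v p.2 < ε / 2 := by
    intro T hT
    obtain ⟨Q, hQ, v, hv⟩ := hFex T hT
    obtain ⟨y, hy, hvy⟩ := htn Q hQ v ⟨T, hT, hv⟩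
    exact ⟨(Q, y), hQ, hy, v, hv, hvy⟩
  choose! c hcF hct hc using hcol
  refine ⟨⋃ Q ∈ F, (Prod.mk Q) '' t Q, c, hF.biUnion fun Q hQ => (ht Q hQ).image _,
    fun T hT => Set.mem_biUnion (hcF T hT) ⟨_, hct T hT, rfl⟩, fun T hT S hS hTS => ?_⟩
  obtain ⟨v, hv, hvy⟩ := hc T hT
  obtain ⟨w, hw, hwy⟩ := hc S hS
  rw [← hTS] at hw hwy
  have hx : ‖w - v‖ < ε := by
    rw [← dist_eq_norm]
    linarith [dist_triangle_right w v (c T).2]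
  have heq : patchAt (max R 0 + ε) S = (w - v) +ᵥ patchAt (max R 0 + ε) T := by
    rw [hw, hv, ← add_vadd, sub_add_cancel]
  refine ⟨w - v, hx, fun z hz τ hτ => ⟨fun h => ?_, fun h => ?_⟩⟩
  · have h1 : τ ∈ patchAt (max R 0 + ε) S :=
      ⟨h, z, by simpa using (hz.trans (le_max_left R 0)).trans (by linarith), hτ⟩
    rw [heq, mem_vadd_collection] at h1
    exact mem_vadd_collection.mpr h1.1
  · rw [mem_vadd_collection] at h
    have h1 : (-(w - v)) +ᵥ τ ∈ patchAt (max R 0 + ε) T := by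
      refine ⟨h, z - (w - v), ?_, ?_⟩
      · rw [mem_closedBall_zero_iff]
        have := norm_sub_le z (w - v)
        linarith [le_max_left R 0]
      · rwa [Tile.mem_vadd_spt, sub_neg_eq_add, sub_add_cancel]
    rw [← mem_vadd_collection, ← heq] at h1
    exact h1.1

/-- Sequential compactness of the tiling space up to bounded translations. -/
theorem exists_limit (hFLC : HasFLC Φ.tilingSpace) :
    ∃ D : ℝ, 0 ≤ D ∧ ∀ S : ℕ → Set (Tile d M), (∀ n, S n ∈ Φ.tilingSpace) →
      ∃ T ∈ Φ.tilingSpace, ∀ R : ℝ, ∀ᶠ n in (hyperfilter ℕ : Filter ℕ), ∃ v : E d, ‖v‖ ≤ D ∧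
        ∀ z : E d, ‖z‖ ≤ R → AgreeAt z T (v +ᵥ S n) := by
  obtain ⟨D, hD0, hD⟩ := Φ.exists_norm_le_of_prototile
  refine ⟨D, hD0, fun S hS => ?_⟩
  -- A shift by at most `D` puts a prototile in its own position into the tiling. This removes the
  -- continuous freedom of translation, so that patches stabilise exactly along the ultrafilter.
  have h1 : ∀ n, ∃ ρ ∈ Φ.prototiles, ∃ v : E d, ‖v‖ ≤ D ∧ ρ ∈ v +ᵥ S n := by
    intro n
    obtain ⟨τ, hτ, hx⟩ := (hS n).1.exists_mem 0
    obtain ⟨ρ, hρ, v, rfl⟩ := hasPrototiles_of_mem (hS n) _ hτ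
    rw [Tile.mem_vadd_spt] at hx
    refine ⟨ρ, hρ, -v, ?_, ?_⟩
    · simpa using hD ρ hρ _ hx
    · rwa [mem_vadd_collection, neg_neg]
  choose r hr v hv hrv using h1
  obtain ⟨ρ, hρ, hev⟩ := exists_eventually_eq_of_finite (f := r) Φ.finite_prototiles
    (Eventually.of_forall hr)
  obtain ⟨x₀, hx₀⟩ := ρ.nonempty_spt
  set Q : ℕ → Set (Tile d M) := fun n => v n +ᵥ S n with hQdef
  have hQ : ∀ n, Q n ∈ Φ.tilingSpace := fun n => vadd_mem_tilingSpace (hS n) _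
  have hstab : ∀ R : ℝ, ∃ P : Set (Tile d M), ∀ᶠ n in (hyperfilter ℕ : Filter ℕ),
      patchAt (max R D) (Q n) = P := by
    intro R
    obtain ⟨F, hF, hFfin, hFex⟩ := exists_finite_patchAt hFLC (max R D)
    -- A translate of the finite patch `q` that contains `ρ` moves one of its tiles onto `ρ`, which
    -- leaves finitely many offsets.
    have hfin : {P : Set (Tile d M) | ∃ q ∈ F, ∃ w : E d, P = w +ᵥ q ∧ ρ ∈ P}.Finite := by
      have h2 : ∀ q ∈ F, {w : E d | ρ ∈ w +ᵥ q}.Finite := by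
        intro q hq
        refine (Set.Finite.preimage (f := fun w : E d => (-w) +ᵥ ρ) ?_ (hFfin q hq)).subset
          fun w hw => mem_vadd_collection.mp hw
        intro a _ b _ h
        exact neg_injective (Tile.vadd_right_injective h)
      refine (hF.biUnion fun q hq => (h2 q hq).image fun w => w +ᵥ q).subset ?_
      rintro _ ⟨q, hq, w, rfl, hρ⟩
      exact Set.mem_biUnion hq ⟨w, hρ, rfl⟩
    obtain ⟨P, -, hP⟩ := exists_eventually_eq_of_finite (f := fun n => patchAt (max R D) (Q n))
      hfin (by
        filter_upwards [hev] with n hn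
        obtain ⟨q, hq, w, hw⟩ := hFex (Q n) (hQ n)
        refine ⟨q, hq, w, hw, ?_, x₀, ?_, hx₀⟩
        · rw [← hn]; exact hrv n
        · simpa using Or.inr (hD ρ hρ _ hx₀))
    exact ⟨P, hP⟩
  have hlim : ∀ R : ℝ, ∀ᶠ n in (hyperfilter ℕ : Filter ℕ),
      ∀ z : E d, ‖z‖ ≤ R → AgreeAt z (ultralimit Q) (Q n) := by
    intro R
    obtain ⟨P, hP⟩ := hstab R
    filter_upwards [hP] with n hn z hz τ hτ
    have hmem : ∀ m, τ ∈ Q m ↔ τ ∈ patchAt (max R D) (Q m) := fun m =>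
      ⟨fun h => ⟨h, z, by simpa using Or.inl hz, hτ⟩, fun h => h.1⟩
    have h2 : ∀ᶠ m in (hyperfilter ℕ : Filter ℕ), (τ ∈ Q m ↔ τ ∈ Q n) := by
      filter_upwards [hP] with m hm
      rw [hmem m, hmem n, hm, hn]
    constructor
    · intro h
      obtain ⟨m, hm, hm'⟩ := (h2.and h).exists
      exact hm.mp hm'
    · intro h
      exact h2.mono fun m hm => hm.mpr h
  refine ⟨ultralimit Q, ⟨⟨isPatch_ultralimit (Eventually.of_forall fun n => (hQ n).1.1),
    Set.eq_univ_of_forall fun x => mem_support.mpr ?_⟩, fun P hP hfin =>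
      isAllowed_of_subset_ultralimit (Eventually.of_forall fun n => (hQ n).2) hP hfin⟩,
    fun R => (hlim R).mono fun n hn => ⟨v n, hv n, hn⟩⟩
  obtain ⟨n, hn⟩ := (hlim ‖x‖).exists
  obtain ⟨τ, hτ, hx⟩ := (hQ n).1.exists_mem x
  exact ⟨τ, (hn x le_rfl τ hx).mpr hτ, hx⟩

/-! ### Repulsion from non-periodicity -/

/-- No image of a tiling under a power of the substitution is locally periodic on the inflation of
a large ball, with the inflation of a bounded vector as period. -/
theorem exists_not_agreeAfter_vadd (hΦ : Φ.IsSelfSimilar) (hFLC : HasFLC Φ.tilingSpace)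
    (hNP : IsNonPeriodic Φ.tilingSpace) (B : ℝ) :
    ∃ r : ℝ, ∀ S ∈ Φ.tilingSpace, ∀ (m : ℕ) (p : E d), ‖p‖ ≤ B →
      (∀ z : E d, ‖z‖ ≤ r → Φ.AgreeAfter m z S (p +ᵥ S)) → p = 0 := by
  obtain ⟨c, hc, hΛ⟩ := hΦ
  by_contra hcon
  push Not at hcon
  choose S hS m p hp hag hp0 using fun n : ℕ => hcon n
  obtain ⟨D, hD, hlim⟩ := exists_limit hFLC
  obtain ⟨T, hT, hTlim⟩ := hlim S hS
  obtain ⟨K, col, hK, hcolK, hcol⟩ := exists_coloring hFLC B one_pos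
  -- One representative position in `T` for each colour that occurs: up to a shift of norm below 1,
  -- every local picture of `T` appears within the bounded distance `ρ` of the origin.
  have hrep : ∀ k ∈ K, ∃ y : E d, (∃ y' : E d, col ((-y') +ᵥ T) = k) → col ((-y) +ᵥ T) = k := by
    intro k _
    by_cases h : ∃ y' : E d, col ((-y') +ᵥ T) = k
    · exact ⟨h.choose, fun _ => h.choose_spec⟩
    · exact ⟨0, fun h' => absurd h' h⟩
  choose! y hy using hrep
  obtain ⟨ρ, hρ⟩ := (hK.image y).isBounded.exists_norm_le
  have hB : 0 ≤ B := (norm_nonneg _).trans (hp 0)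
  obtain ⟨N, hN⟩ := exists_nat_ge (ρ + 1 + D)
  obtain ⟨n, ⟨v, hv, hTv⟩, hn⟩ :=
    ((hTlim (ρ + 1 + B)).and (eventually_hyperfilter_ge N)).exists
  have hnr : ρ + 1 + D ≤ n := hN.trans (by exact_mod_cast hn)
  -- A single large `n` suffices: the local period of `S n` near the origin passes to `T`, and by
  -- recurrence of pictures from the representative position to every point `a`. Thus `p n` becomes
  -- a global period after `m n` steps; no limit of the `p n` or `m n` is taken.
  have hall : ∀ a : E d, Φ.AgreeAfter (m n) a T (p n +ᵥ T) := by
    intro a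
    have hk := hcolK _ (vadd_mem_tilingSpace hT (-a))
    obtain ⟨x, hx, hxag⟩ := hcol _ (vadd_mem_tilingSpace hT (-(y (col ((-a) +ᵥ T))))) _
      (vadd_mem_tilingSpace hT (-a)) (hy _ hk ⟨a, rfl⟩)
    have hyρ := hρ _ ⟨_, hk, rfl⟩
    rw [← add_vadd] at hxag
    set w := x + -y (col ((-a) +ᵥ T)) with hw
    have hwn : ‖w‖ ≤ ρ + 1 := by
      refine (norm_add_le _ _).trans ?_
      rw [norm_neg]; linarith
    clear_value w
    have e1 : Φ.AgreeAfter (m n) 0 ((-a) +ᵥ T) (w +ᵥ T) :=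
      agreeAfter_of_agreeAt (hxag 0 (by simpa using hB)) _
    have e2 : Φ.AgreeAfter (m n) 0 (w +ᵥ T) (w +ᵥ v +ᵥ S n) := by
      have := (hTv (-w) (by rw [norm_neg]; linarith)).vadd w
      rw [add_neg_cancel] at this
      exact agreeAfter_of_agreeAt this _
    have e3 : Φ.AgreeAfter (m n) 0 (w +ᵥ v +ᵥ S n) (w +ᵥ v +ᵥ p n +ᵥ S n) := by
      have := (hag n (-v + -w) (by
        refine (norm_add_le _ _).trans ?_
        rw [norm_neg, norm_neg]; linarith)).vadd (w + v)
      rw [show w + v + (-v + -w) = 0 by abel, add_vadd, add_vadd] at this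
      exact this
    have e4 : Φ.AgreeAfter (m n) 0 (w +ᵥ v +ᵥ p n +ᵥ S n) (w +ᵥ p n +ᵥ T) := by
      have := (hTv (-(w + p n)) (by
        rw [norm_neg]
        refine (norm_add_le _ _).trans ?_
        linarith [hp n])).symm.vadd (w + p n)
      rw [add_neg_cancel, add_vadd, add_vadd, vadd_comm (p n) v] at this
      exact agreeAfter_of_agreeAt this _
    have e5 : Φ.AgreeAfter (m n) 0 (w +ᵥ p n +ᵥ T) ((-a) +ᵥ p n +ᵥ T) := by
      have := (hxag (-p n) (by rw [norm_neg]; exact hp n)).symm.vadd (p n)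
      rw [add_neg_cancel, vadd_comm (p n), vadd_comm (p n)] at this
      exact agreeAfter_of_agreeAt this _
    have := ((((e1.trans e2).trans e3).trans e4).trans e5).vadd a
    rwa [add_zero, vadd_neg_vadd, vadd_neg_vadd] at this
  have hcm : c ^ m n ≠ 0 := by positivity
  have heq : Φ.map^[m n] T = (c ^ m n • p n) +ᵥ Φ.map^[m n] T := by
    refine eq_of_forall_agreeAt fun a => ?_
    have := hall ((c ^ m n)⁻¹ • a)
    unfold AgreeAfter at this
    rwa [map_iterate_vadd, iterate_Λ_eq hΛ, iterate_Λ_eq hΛ, smul_inv_smul₀ hcm] at this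
  have := hNP _ (iterate_mem_tilingSpace hT (m n)) (-(c ^ m n • p n)) (by rw [neg_neg, ← heq])
  rw [neg_eq_zero, smul_eq_zero] at this
  exact hp0 n (this.resolve_left hcm)

/-- Repulsion: the image of a tiling under a power of the substitution is not locally periodic on
the inflation of a ball of radius `1/2`, with the inflation of a small vector as period. -/
theorem exists_repulsion (hΦ : Φ.IsSelfSimilar) (hFLC : HasFLC Φ.tilingSpace)
    (hNP : IsNonPeriodic Φ.tilingSpace) :
    ∃ ε : ℝ, 0 < ε ∧ ∀ T ∈ Φ.tilingSpace, ∀ (n : ℕ) (x y : E d), ‖x‖ < ε →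
      (∀ z ∈ Metric.closedBall y (1 / 2), Φ.AgreeAfter n z T (x +ᵥ T)) → x = 0 := by
  obtain ⟨c, hc, hΛ⟩ := id hΦ
  have hc0 : 0 < c := by linarith
  obtain ⟨s, hs, hs1, hsep⟩ := Φ.exists_pos_eq_of_agreeAt
  -- The bound `c` fits because `x` will be inflated until its length first reaches `s ≤ 1`, so that
  -- it overshoots by at most a factor `c`.
  obtain ⟨r, hr⟩ := exists_not_agreeAfter_vadd hΦ hFLC hNP c
  -- The second term forces `c ^ k > 2 * (|r| + 1)`, so the ball of radius `1 / 2` inflates past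
  -- radius `r`; the first gives `‖x‖ ≤ c` when `k = 0`.
  refine ⟨min 1 (s / (2 * (|r| + 1))), by positivity, fun T hT n x y hx hag => ?_⟩
  rw [lt_min_iff, lt_div_iff₀ (by positivity)] at hx
  by_contra hx0
  have hxpos := norm_pos_iff.mpr hx0
  have hex : ∃ k, s ≤ c ^ k * ‖x‖ := by
    obtain ⟨k, hk⟩ := pow_unbounded_of_one_lt (s / ‖x‖) hc
    rw [div_lt_iff₀ hxpos] at hk
    exact ⟨k, hk.le⟩
  classical
  have hk := Nat.find_spec hex
  have hkmin := fun j => Nat.find_min hex (m := j)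
  set k := Nat.find hex
  have hkle : c ^ k * ‖x‖ ≤ c := by
    rcases Nat.eq_zero_or_pos k with h0 | hpos
    · rw [h0, pow_zero, one_mul]; linarith
    · obtain ⟨j, hj⟩ : ∃ j, k = j + 1 := ⟨k - 1, by omega⟩
      have := hkmin j (by omega)
      rw [hj, pow_succ]
      nlinarith
  -- Otherwise `c ^ n • x` is still shorter than `s`, and agreement at one point already forces it
  -- to vanish.
  have hkn : k ≤ n := by
    refine Nat.find_min' hex ?_
    by_contra hlt
    have h0 : Φ.AgreeAfter n y T (x +ᵥ T) := hag y (Metric.mem_closedBall_self (by norm_num))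
    unfold AgreeAfter at h0
    rw [map_iterate_vadd, iterate_Λ_eq hΛ n x] at h0
    have h1 := hsep _ (iterate_mem_tilingSpace hT n) _ 0 (c ^ n • x) (by
      rw [zero_sub, norm_neg, norm_smul, Real.norm_of_nonneg (by positivity)]
      exact not_le.mp hlt) (by rw [zero_vadd]; exact h0)
    exact hx0 ((smul_eq_zero.mp h1.symm).resolve_left (by positivity))
  have hck : 2 * (|r| + 1) < c ^ k := by
    refine lt_of_mul_lt_mul_right (a := ‖x‖) ?_ hxpos.le
    linarith [hx.2]
  have hckpos : 0 < c ^ k := by positivity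
  have hp := hr (Φ.map^[k] ((-y) +ᵥ T)) (iterate_mem_tilingSpace (vadd_mem_tilingSpace hT _) k)
    (n - k) (c ^ k • x) (by rwa [norm_smul, Real.norm_of_nonneg hckpos.le]) (fun z hz => by
      have hz' : ‖(c ^ k)⁻¹ • z‖ ≤ 1 / 2 := by
        rw [norm_smul, norm_inv, Real.norm_of_nonneg hckpos.le, inv_mul_le_iff₀ hckpos]
        linarith [le_abs_self r]
      have h1 := (hag (y + (c ^ k)⁻¹ • z) (by simpa using hz')).vadd (-y)
      rw [neg_add_cancel_left, vadd_comm, show n = n - k + k by omega, agreeAfter_add,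
        map_iterate_vadd k x, iterate_Λ_eq hΛ, iterate_Λ_eq hΛ,
        smul_inv_smul₀ hckpos.ne'] at h1
      exact h1)
  exact hx0 ((smul_eq_zero.mp hp).resolve_left hckpos.ne')

/-! ### Pairs with a closed half-space of agreement: rigidity, finiteness, periodicity -/

variable (Φ) in
/-- The pairs of tilings that are stably equivalent along a closed half-space punctured at the
origin, but not at the origin. -/
def closedBranchPairs (u : E d) : Set (Set (Tile d M) × Set (Tile d M)) :=
  {p | p.1 ∈ Φ.tilingSpace ∧ p.2 ∈ Φ.tilingSpace ∧ (∀ n, ¬ Φ.AgreeAfter n 0 p.1 p.2) ∧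
    ∀ x : E d, x ≠ 0 → 0 ≤ inner ℝ x u → ∃ n, Φ.AgreeAfter n x p.1 p.2}

/-- Every pair in `closedBranchPairs` is the image of another such pair. -/
theorem exists_map_mem_closedBranchPairs (hΦ : Φ.IsSelfSimilar) (u : Directions d)
    {p : Set (Tile d M) × Set (Tile d M)} (hp : p ∈ Φ.closedBranchPairs (u : E d)) :
    ∃ q ∈ Φ.closedBranchPairs (u : E d), (Φ.map q.1, Φ.map q.2) = p := by
  obtain ⟨c, hc, hΛ⟩ := hΦ
  obtain ⟨hT, hT', h0, hu⟩ := hp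
  obtain ⟨T₁, hT₁, h1⟩ := exists_map_eq u hT
  obtain ⟨T₁', hT₁', h1'⟩ := exists_map_eq u hT'
  have key : ∀ (n : ℕ) (x : E d),
      Φ.AgreeAfter (n + 1) x T₁ T₁' ↔ Φ.AgreeAfter n (c • x) p.1 p.2 := by
    intro n x
    rw [agreeAfter_add, Function.iterate_one, Function.iterate_one, h1, h1', hΛ]
  refine ⟨(T₁, T₁'), ⟨hT₁, hT₁', fun n h => ?_, fun x hx hxu => ?_⟩, by rw [h1, h1']⟩
  · have := (key n 0).mp h.succ
    rw [smul_zero] at this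
    exact h0 n this
  · obtain ⟨n, hn⟩ := hu (c • x) (smul_ne_zero (by positivity) hx) (by
      rw [real_inner_smul_left]; positivity)
    exact ⟨n + 1, (key n x).mpr hn⟩

/-- If the patches about the origin of two pairs in `closedBranchPairs` differ by small
translations, then these translations are trivial. -/
theorem exists_rigidity (hΦ : Φ.IsSelfSimilar) (hFLC : HasFLC Φ.tilingSpace)
    (hNP : IsNonPeriodic Φ.tilingSpace) (u : Directions d) :
    ∃ ε : ℝ, 0 < ε ∧ ∀ p ∈ Φ.closedBranchPairs (u : E d), ∀ q ∈ Φ.closedBranchPairs (u : E d),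
      ∀ x x' : E d, ‖x‖ < ε → ‖x'‖ < ε →
        (∀ z : E d, ‖z‖ ≤ 4 → AgreeAt z q.1 (x +ᵥ p.1)) →
        (∀ z : E d, ‖z‖ ≤ 4 → AgreeAt z q.2 (x' +ᵥ p.2)) → x = 0 ∧ x' = 0 := by
  obtain ⟨ε, hε, hrep⟩ := exists_repulsion hΦ hFLC hNP
  refine ⟨min (1 / 2) (ε / 2), by positivity, fun p hp q hq x x' hx hx' h1 h2 => ?_⟩
  rw [lt_min_iff] at hx hx'
  obtain ⟨hT, hT', hp0, hpu⟩ := hp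
  obtain ⟨hS, hS', hq0, hqu⟩ := hq
  have hu : ‖(u : E d)‖ = 1 := by simp
  -- A compact ball well inside the half-space, with room to shift a concentric ball of radius `1 /
  -- 2` by less than `1 / 2`; all of it lies in the ball of radius 4 where the patches are compared.
  have hball : ∀ z ∈ Metric.closedBall ((2 : ℝ) • (u : E d)) 1,
      z ≠ 0 ∧ 0 ≤ inner ℝ z (u : E d) := by
    intro z hz
    rw [mem_closedBall_iff_norm] at hz
    have e1 := abs_real_inner_le_norm (z - (2 : ℝ) • (u : E d)) (u : E d)
    rw [inner_sub_left, real_inner_smul_left, real_inner_self_eq_norm_sq, hu] at e1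
    have e2 := neg_le_of_abs_le e1
    have e3 : 1 ≤ inner ℝ z (u : E d) := by linarith
    refine ⟨?_, by linarith⟩
    rintro rfl
    rw [inner_zero_left] at e3
    linarith
  have hK := isCompact_closedBall ((2 : ℝ) • (u : E d)) 1
  obtain ⟨N, hN⟩ := exists_agreeAfter_of_isCompact hK hT hT' fun z hz =>
    hpu z (hball z hz).1 (hball z hz).2
  obtain ⟨N', hN'⟩ := exists_agreeAfter_of_isCompact hK hS hS' fun z hz =>
    hqu z (hball z hz).1 (hball z hz).2
  -- Near `2u - x`, going from `p.2` to `p.1`, on to `q.1`, `q.2` and back to `p.2` produces the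
  -- local period `-x + x'`, which repulsion kills.
  have hxx : -x + x' = 0 := by
    refine hrep p.2 hT' (max N N') (-x + x') ((2 : ℝ) • (u : E d) - x) ?_ fun z hz => ?_
    · refine (norm_add_le _ _).trans_lt ?_
      rw [norm_neg]; linarith
    · have hz1 : ‖(x + z) - (2 : ℝ) • (u : E d)‖ ≤ 1 / 2 := by
        rw [mem_closedBall_iff_norm] at hz
        rwa [show x + z - (2 : ℝ) • (u : E d) = z - ((2 : ℝ) • (u : E d) - x) by abel]
      have hz2 : ‖z - (2 : ℝ) • (u : E d)‖ ≤ 1 := by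
        rw [show z - (2 : ℝ) • (u : E d) = (x + z - (2 : ℝ) • (u : E d)) - x by abel]
        refine (norm_sub_le _ _).trans ?_
        linarith
      have hz4 : ‖x + z‖ ≤ 4 := by
        rw [show x + z = (x + z - (2 : ℝ) • (u : E d)) + (2 : ℝ) • (u : E d) by abel]
        refine (norm_add_le _ _).trans ?_
        rw [norm_smul, hu, Real.norm_ofNat]
        linarith
      have a1 := (hN (max N N') (le_max_left _ _) z (mem_closedBall_iff_norm.mpr hz2)).symm
      have a2 := agreeAfter_of_agreeAt (Φ := Φ) (h1 (x + z) hz4) (max N N')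
      have a3 := hN' (max N N') (le_max_right _ _) (x + z)
        (mem_closedBall_iff_norm.mpr (hz1.trans (by norm_num)))
      have a4 := agreeAfter_of_agreeAt (Φ := Φ) (h2 (x + z) hz4) (max N N')
      have a5 := ((a2.symm.trans a3).trans a4).vadd (-x)
      rw [neg_add_cancel_left, neg_vadd_vadd, ← add_vadd] at a5
      exact a1.trans a5
  obtain rfl : x = x' := by rwa [neg_add_eq_zero] at hxx
  suffices h : x = 0 from ⟨h, h⟩
  have htrans : ∀ (n : ℕ) (z : E d), ‖x + z‖ ≤ 4 →
      (Φ.AgreeAfter n (x + z) q.1 q.2 ↔ Φ.AgreeAfter n z p.1 p.2) := by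
    intro n z hz
    have a1 := agreeAfter_of_agreeAt (Φ := Φ) (h1 (x + z) hz) n
    have a2 := agreeAfter_of_agreeAt (Φ := Φ) (h2 (x + z) hz) n
    constructor
    · intro h
      have := ((a1.symm.trans h).trans a2).vadd (-x)
      rwa [neg_add_cancel_left, neg_vadd_vadd, neg_vadd_vadd] at this
    · intro h
      exact (a1.trans (h.vadd x)).trans a2.symm
  by_contra hx0
  -- One of `x`, `-x` lies in the closed half-space. There one pair eventually agrees at a point
  -- that corresponds to the origin of the other, where agreement never occurs. Closedness covers
  -- `x` orthogonal to `u`.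
  rcases le_total 0 (inner ℝ x (u : E d)) with hpos | hneg
  · obtain ⟨n, hn⟩ := hqu x hx0 hpos
    refine hp0 n ((htrans n 0 ?_).mp (by rwa [add_zero]))
    rw [add_zero]; linarith
  · obtain ⟨n, hn⟩ := hpu (-x) (neg_ne_zero.mpr hx0) (by rw [inner_neg_left]; linarith)
    have := (htrans n (-x) (by simp)).mpr hn
    rw [add_neg_cancel] at this
    exact hq0 n this

/-- The limiting colour of a backward orbit takes finitely many values and determines the pair. -/
theorem finite_closedBranchPairs (hΦ : Φ.IsSelfSimilar) (hFLC : HasFLC Φ.tilingSpace)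
    (hNP : IsNonPeriodic Φ.tilingSpace) (u : Directions d) :
    (Φ.closedBranchPairs (u : E d)).Finite := by
  obtain ⟨ε, hε, hrig⟩ := exists_rigidity hΦ hFLC hNP u
  obtain ⟨K, col, hK, hcolK, hcol⟩ := exists_coloring hFLC 4 hε
  choose! g hg hgmap using fun p => exists_map_mem_closedBranchPairs hΦ u (p := p)
  obtain ⟨c, hc, hΛ⟩ := hΦ
  have hgn : ∀ n : ℕ, ∀ p ∈ Φ.closedBranchPairs (u : E d),
      g^[n] p ∈ Φ.closedBranchPairs (u : E d) ∧
        Φ.map^[n] (g^[n] p).1 = p.1 ∧ Φ.map^[n] (g^[n] p).2 = p.2 := by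
    intro n
    induction n with
    | zero => exact fun p hp => ⟨hp, rfl, rfl⟩
    | succ n ih =>
      intro p hp
      obtain ⟨i1, i2, i3⟩ := ih p hp
      have h1 : Φ.map (g (g^[n] p)).1 = _ := congrArg Prod.fst (hgmap _ i1)
      have h2 : Φ.map (g (g^[n] p)).2 = _ := congrArg Prod.snd (hgmap _ i1)
      rw [Function.iterate_succ_apply', Function.iterate_succ_apply, Function.iterate_succ_apply]
      refine ⟨hg _ i1, ?_, ?_⟩
      · rw [h1, i2]
      · rw [h2, i3]
  have hlim : ∀ p ∈ Φ.closedBranchPairs (u : E d), ∃ k ∈ K ×ˢ K,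
      ∀ᶠ n in (hyperfilter ℕ : Filter ℕ), (col (g^[n] p).1, col (g^[n] p).2) = k := by
    intro p hp
    refine exists_eventually_eq_of_finite (hK.prod hK) (Eventually.of_forall fun n => ?_)
    obtain ⟨h1, h2, -⟩ := (hgn n p hp).1
    exact ⟨hcolK _ h1, hcolK _ h2⟩
  choose! k hkK hk using hlim
  refine Set.Finite.of_finite_image ((hK.prod hK).subset (Set.image_subset_iff.mpr hkK)) ?_
  intro p hp q hq hpq
  have hagree : ∀ z : E d, AgreeAt z q.1 p.1 ∧ AgreeAt z q.2 p.2 := by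
    intro z
    -- Go back `n ≥ N` steps to a time when the colours coincide. Rigidity makes both small
    -- translations zero, and agreement on the ball of radius 4 inflates forward to include `z`.
    obtain ⟨N, hN⟩ := pow_unbounded_of_one_lt ‖z‖ hc
    obtain ⟨n, ⟨h1, h2⟩, h3⟩ :=
      (((hk p hp).and (hk q hq)).and (eventually_hyperfilter_ge N)).exists
    obtain ⟨hpn, hp1, hp2⟩ := hgn n p hp
    obtain ⟨hqn, hq1, hq2⟩ := hgn n q hq
    rw [hpq, ← h2, Prod.mk.injEq] at h1
    obtain ⟨x, hx, hxag⟩ := hcol _ hpn.1 _ hqn.1 h1.1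
    obtain ⟨x', hx', hxag'⟩ := hcol _ hpn.2.1 _ hqn.2.1 h1.2
    obtain ⟨rfl, rfl⟩ := hrig _ hpn _ hqn x x' hx hx' hxag hxag'
    have hcn : 0 < c ^ n := by positivity
    have hz : ‖(c ^ n)⁻¹ • z‖ ≤ 4 := by
      rw [norm_smul, norm_inv, Real.norm_of_nonneg hcn.le, inv_mul_le_iff₀ hcn]
      have := pow_le_pow_right₀ hc.le h3
      linarith
    have a1 := agreeAfter_of_agreeAt (Φ := Φ) (hxag _ hz) n
    have a2 := agreeAfter_of_agreeAt (Φ := Φ) (hxag' _ hz) n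
    unfold AgreeAfter at a1 a2
    rw [zero_vadd, iterate_Λ_eq hΛ, smul_inv_smul₀ hcn.ne'] at a1 a2
    rw [hp1, hq1] at a1
    rw [hp2, hq2] at a2
    exact ⟨a1, a2⟩
  exact (Prod.ext (eq_of_forall_agreeAt fun z => (hagree z).1)
    (eq_of_forall_agreeAt fun z => (hagree z).2)).symm

/-- A backward orbit `g^[n] p` in a finite set has a repetition at times `i < j`; pushing it forward
`j` steps gives period `j - i` for `p` itself. -/
theorem isPeriodic_of_mem_closedBranchPairs (hΦ : Φ.IsSelfSimilar) (hFLC : HasFLC Φ.tilingSpace)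
    (hNP : IsNonPeriodic Φ.tilingSpace) (u : Directions d)
    {p : Set (Tile d M) × Set (Tile d M)} (hp : p ∈ Φ.closedBranchPairs (u : E d)) :
    Φ.IsPeriodic p.1 ∧ Φ.IsPeriodic p.2 := by
  have hfin := finite_closedBranchPairs hΦ hFLC hNP u
  set f : Set (Tile d M) × Set (Tile d M) → Set (Tile d M) × Set (Tile d M) :=
    fun q => (Φ.map q.1, Φ.map q.2) with hf
  choose! g hg hgf using fun p => exists_map_mem_closedBranchPairs hΦ u (p := p)
  have hmem : ∀ n, g^[n] p ∈ Φ.closedBranchPairs (u : E d) := by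
    intro n
    induction n with
    | zero => exact hp
    | succ n ih => rw [Function.iterate_succ_apply']; exact hg _ ih
  have hback : ∀ n, f^[n] (g^[n] p) = p := by
    intro n
    induction n with
    | zero => rfl
    | succ n ih =>
      rw [Function.iterate_succ_apply f, Function.iterate_succ_apply' g]
      exact (congrArg _ (hgf _ (hmem n))).trans ih
  obtain ⟨i, j, hij, heq⟩ : ∃ i j : ℕ, i < j ∧ g^[i] p = g^[j] p := by
    obtain ⟨i, -, j, -, hne, h⟩ := Set.infinite_univ.exists_ne_map_eq_of_mapsTo
      (f := fun n => g^[n] p) (fun n _ => hmem n) hfin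
    rcases lt_or_gt_of_ne hne with h' | h'
    · exact ⟨i, j, h', h⟩
    · exact ⟨j, i, h', h.symm⟩
  have hper : f^[j - i] p = p := by
    conv_lhs => rw [← hback i, heq, ← Function.iterate_add_apply]
    rw [Nat.sub_add_cancel hij.le, hback]
  have hfn : ∀ n, f^[n] p = (Φ.map^[n] p.1, Φ.map^[n] p.2) := by
    intro n
    induction n with
    | zero => rfl
    | succ n ih => simp only [Function.iterate_succ_apply' _ n, ih]; rfl
  rw [hfn] at hper
  exact ⟨⟨j - i, by omega, congrArg Prod.fst hper⟩, ⟨j - i, by omega, congrArg Prod.snd hper⟩⟩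

/-- A nonzero point of the closed half-space is `‖x‖` times a direction in the closed hemisphere,
and translating by `x` moves agreement at the origin to agreement at `x`. -/
theorem mem_closedBranchPairs_of_isBranchPair (hΦ : Φ.IsSelfSimilar) {u : Directions d}
    {T T' : Set (Tile d M)} (h : Φ.IsBranchPair T T')
    (hu : {v : Directions d | 0 ≤ inner ℝ (v : E d) (u : E d)} ⊆ Φ.stableDirections T T') :
    (T, T') ∈ Φ.closedBranchPairs (u : E d) := by
  obtain ⟨hT, hT', hn, -⟩ := h
  rw [stablyEquiv_iff hΦ hT hT', not_exists] at hn
  refine ⟨hT, hT', hn, fun x hx hxu => ?_⟩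
  have hx' : 0 < ‖x‖ := norm_pos_iff.mpr hx
  have h1 := hu (show (⟨‖x‖⁻¹ • x, by simp [norm_smul, hx]⟩ : Directions d) ∈ _ by
    show 0 ≤ inner ℝ (‖x‖⁻¹ • x) (u : E d)
    rw [real_inner_smul_left]; positivity) ‖x‖ hx'
  rw [smul_inv_smul₀ hx'.ne', stablyEquiv_iff hΦ (vadd_mem_tilingSpace hT _)
    (vadd_mem_tilingSpace hT' _)] at h1
  obtain ⟨n, hn⟩ := h1
  refine ⟨n, ?_⟩
  have := hn.vadd x
  rwa [add_zero, vadd_neg_vadd, vadd_neg_vadd] at this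

end Substitution
end SubstTiling

theorem mainTheorem7 {d : ℕ} {M : Type*} [Finite M] (Φ : SubstTiling.Substitution d M)
    (hΦ : Φ.IsSelfSimilar)
    (hFLC : SubstTiling.HasFLC Φ.tilingSpace)
    (hNP : SubstTiling.IsNonPeriodic Φ.tilingSpace)
    (S : Set (SubstTiling.Directions d))
    (hS : SubstTiling.ContainsClosedHemisphereInInterior S) :
    (∀ (T T' : Set (SubstTiling.Tile d M)) (C : Set (SubstTiling.Directions d)),
      Φ.IsBranchPair T T' → Φ.IsAsymptoticSector T T' C → S ⊆ C →
        Φ.IsPeriodic T ∧ Φ.IsPeriodic T') ∧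
    {p : Set (SubstTiling.Tile d M) × Set (SubstTiling.Tile d M) |
      Φ.IsBranchPair p.1 p.2 ∧ ∃ C, Φ.IsAsymptoticSector p.1 p.2 C ∧ S ⊆ C}.Finite := by
  obtain ⟨u, hu⟩ := hS
  have key : ∀ (T T' : Set (SubstTiling.Tile d M)) (C : Set (SubstTiling.Directions d)),
      Φ.IsBranchPair T T' → Φ.IsAsymptoticSector T T' C → S ⊆ C →
        (T, T') ∈ Φ.closedBranchPairs (u : SubstTiling.E d) := by
    rintro T T' C hb ⟨-, -, ⟨w, -, rfl⟩, -⟩ hSC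
    exact SubstTiling.Substitution.mem_closedBranchPairs_of_isBranchPair hΦ hb
      (((hu.trans interior_subset).trans hSC).trans (connectedComponentIn_subset _ _))
  refine ⟨fun T T' C hb hC hSC =>
    SubstTiling.Substitution.isPeriodic_of_mem_closedBranchPairs hΦ hFLC hNP u
      (key T T' C hb hC hSC), ?_⟩
  refine (SubstTiling.Substitution.finite_closedBranchPairs hΦ hFLC hNP u).subset ?_
  rintro ⟨T, T'⟩ ⟨hb, C, hC, hSC⟩
  exact key T T' C hb hC hSC
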